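/- Let $d\ge 0$ and let $P\subset\mathbb{R}^d$ be a polytope. A coordinate subspace of $\mathbb{R}^d$ is the linear span of a subset of the standard basis $e_1,\dots,e_d$. Suppose that $P$ is locally anti-blocking, i.e. for every coordinate subspace $H$ the orthogonal projection of $P$ onto $H$ equals $P\cap H$, and normalized, i.e. $\max_{x\in P}\langle x,e_i\rangle=\max_{x\in P}\langle x,-e_i\rangle=1$ for all $i$ (so that $P$ is $d$-dimensional when $d\ge 1$). A (full) flag of an $n$-dimensional polytope $Q$ is a tuple $F_{-1}\subsetneq F_0\subsetneq\dots\subsetneq F_n$ of faces of $Q$ with $\dim F_i=i$ for all $-1\le i\le n$, where $F_{-1}=\emptyset$ has dimension $-1$ and $F_n=Q$. Assume that $P$ has exactly $2^d\cdot d!$ flags. Then: 1. For every coordinate subspace $H$ of $\mathbb{R}^d$, the section $P\cap H$ has exactly $2^{\dim H}\cdot(\dim H)!$ flags. 2. For every coordinate subspace $H$ of $\mathbb{R}^d$ with $\dim H=2$, either $P\cap H=[-1,1]^d\cap H$ (a square), or $P\cap H=\{x\in\mathbb{R}^d : |x_1|+\dots+|x_d|\le 1\}\cap H$ (a diamond).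 -/

import Mathlib

open scoped Nat RealInnerProductSpace

noncomputable section

namespace FlagPolytope

/-- A polytope in `ℝ^d`: a compact set which is the intersection of finitely many closed
half-spaces `{x | ⟪ν, x⟫ ≤ c}`, each recorded as a pair `(ν, c)`. -/
def IsPolytope {d : ℕ} (P : Set (EuclideanSpace ℝ (Fin d))) : Prop :=
  IsCompact P ∧
    ∃ S : Finset (EuclideanSpace ℝ (Fin d) × ℝ), P = {x | ∀ s ∈ S, ⟪s.1, x⟫ ≤ s.2}

/-- `F` is a face of `P`: either `F = ∅`, or `F` is the set of maximizers over `P` of some linear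
functional (the zero functional gives `P` itself). -/
def IsFace {d : ℕ} (P F : Set (EuclideanSpace ℝ (Fin d))) : Prop :=
  IsExposed ℝ P F

open scoped Classical in
/-- The dimension of a set is the dimension of its affine span, and `-1` for the empty set. -/
def dim {d : ℕ} (A : Set (EuclideanSpace ℝ (Fin d))) : ℤ :=
  if A.Nonempty then (Module.finrank ℝ (vectorSpan ℝ A) : ℤ) else -1

/-- The set of (full) flags `(F_{-1}, F_0, …, F_n)` of `P`, where `n = dim P`: strictly increasing
families of faces of `P`, with `F_i` of dimension `i` for every `-1 ≤ i ≤ n`. -/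
def flags {d : ℕ} (P : Set (EuclideanSpace ℝ (Fin d))) :
    Set (Set.Icc (-1 : ℤ) (dim P) → Set (EuclideanSpace ℝ (Fin d))) :=
  {F | (∀ i, IsFace P (F i) ∧ dim (F i) = (i : ℤ)) ∧ ∀ i j, i < j → F i ⊂ F j}

/-- Coordinate subspaces of `ℝ^d`: the spans of subsets of the standard basis. -/
def IsCoordinateSubspace {d : ℕ} (H : Submodule ℝ (EuclideanSpace ℝ (Fin d))) : Prop :=
  ∃ J : Set (Fin d),
    H = Submodule.span ℝ ((fun j : Fin d => EuclideanSpace.single j (1 : ℝ)) '' J)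

/-- `P` is locally anti-blocking: for each coordinate subspace `H`, the orthogonal projection of
`P` onto `H` equals `P ∩ H`. -/
def IsLocallyAntiBlocking {d : ℕ} (P : Set (EuclideanSpace ℝ (Fin d))) : Prop :=
  ∀ H : Submodule ℝ (EuclideanSpace ℝ (Fin d)), IsCoordinateSubspace H →
    (fun x => H.starProjection x) '' P = P ∩ (H : Set (EuclideanSpace ℝ (Fin d)))

/-- `P` is normalized: `max_{x ∈ P} ⟪x, e_i⟫ = 1` and `max_{x ∈ P} ⟪x, -e_i⟫ = 1` for each
standard basis vector `e_i` (the maxima are attained). -/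
def IsNormalized {d : ℕ} (P : Set (EuclideanSpace ℝ (Fin d))) : Prop :=
  ∀ i : Fin d,
    IsGreatest ((fun x => ⟪x, EuclideanSpace.single i (1 : ℝ)⟫) '' P) 1 ∧
    IsGreatest ((fun x => ⟪x, -EuclideanSpace.single i (1 : ℝ)⟫) '' P) 1

/-- The cube `[-1, 1]^d`. -/
def cube (d : ℕ) : Set (EuclideanSpace ℝ (Fin d)) := {x | ∀ i, |x i| ≤ 1}

/-- The diamond (cross-polytope) `{x | |x_1| + … + |x_d| ≤ 1}`. -/
def diamond (d : ℕ) : Set (EuclideanSpace ℝ (Fin d)) := {x | ∑ i, |x i| ≤ 1}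

end FlagPolytope

end

/-!
Call a pair `A ⊆ B` of faces a *wall* if, for some coordinate `i`, the face `A` lies in the hyperplane
`x i = 0`, the face `B` does not, and `B` is closed under the projection that sets the `i`-th
coordinate to `0`. Call a flag *wall-free* if no member is a wall over the preceding one, and let
`f (P)` and `g (P) ≤ f (P)` be the numbers of all flags and of wall-free flags. The letter `P` stands
for the given polytope or one of its coordinate sections, and `P_i` for its section by `x i = 0`.

**Lower bound.** The inequality `g (P) ≥ 2 ∑ i, g (P_i)` (`sum_lifts_le`) gives `g (P) ≥ 2 ^ n * n !`
by induction on `n = dim P` (`le_ncard_wallFree`). It comes from lifting flags. Given a coordinate `i`,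
a sign and a flag `G` of `P_i`, there is a flag `F` of `P` whose vertex lies strictly on the given
side of `x i = 0` and such that `F (k + 1)` meets this hyperplane in `G k` (`exists_lift`); if `G` is
wall-free, so is `F` (`wallFree_of_sec`). Obviously `F` determines `G` and, for given `i`, the sign.
It also determines `i` (`lift_disjoint`). Suppose `F` is a lift for both `i` and `j`, and let `v` be
its vertex. In the first member `B` of `F` whose two sections differ, the preceding member `A` is the
facet where `x i / v i = x j / v j`. If, say, `x j / v j` is the larger ratio on the rest of `B`, then
`B` contains a point `z` with `z j = 0` and `z i` of sign opposite to `v i`. As `B` has points on both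
sides of `x i = 0` and `P` is closed under the projection to this hyperplane, a functional exposing `B`
cannot depend on `x i`, and the sections of `A` and `B` by `x j = 0` form a wall.

**Equality.** If `f (P) = 2 ^ n * n !`, then `f (P) = g (P)`: there are no walls among the flags of `P`.
A wall in a flag of `P_i` would have as preimage, under the projection of `P` to `P_i`, a wall of `P`,
again of two consecutive dimensions, and this would extend to a flag (`wallFree_inter_hyp`). So
`f (P_i) = g (P_i)`, and `g (P_i)` is minimal because equality holds in every step of the lower bound
(`ncard_wallFree_eq`). Removing one coordinate after the other yields the first claim.

**Planar sections.** Equality also says that every flag is a lift. In the plane this means that every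
edge passes through one of `± e i`, `± e j`, and that an edge at the vertex `± e i` passes through
one of `± e j`. Hence the edges that meet an open quadrant lie on the three lines bounding the square
and the diamond (`IsMinimal.edge_eq`), so each quadrant is that of the square or of the diamond
(`IsMinimal.quadrant`). Neighbouring quadrants have the same shape, since otherwise an edge of the
square would be a wall over the vertex between them (`IsMinimal.corner_neg`).
-/

namespace FlagPolytope

variable {d : ℕ}

local notation "𝔼" => EuclideanSpace ℝ (Fin d)

/-! ### Polytopes and their faces -/

theorem IsPolytope.convex {P : Set 𝔼} (hP : IsPolytope P) : Convex ℝ P := by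
  obtain ⟨-, S, rfl⟩ := hP
  have : {x : 𝔼 | ∀ s ∈ S, ⟪s.1, x⟫ ≤ s.2} = ⋂ s ∈ S, {x | innerSL ℝ s.1 x ≤ s.2} := by
    ext x; simp
  rw [this]
  exact convex_iInter₂ fun s _ => convex_halfSpace_le (innerSL ℝ s.1).isLinear s.2

/-- An extreme point is determined by the set of inequalities which are tight at it. -/
theorem IsPolytope.finite_extremePoints {P : Set 𝔼} (hP : IsPolytope P) :
    (P.extremePoints ℝ).Finite := by
  classical
  obtain ⟨-, S, rfl⟩ := hP
  refine Set.Finite.of_finite_image (f := fun x => S.filter fun s => ⟪s.1, x⟫ = s.2)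
    ((S.powerset.finite_toSet).subset ?_) ?_
  · rintro _ ⟨x, -, rfl⟩
    exact Finset.mem_coe.2 (Finset.mem_powerset.2 (Finset.filter_subset _ _))
  · intro x hx y hy hxy
    -- If the same inequalities are tight at `x` and `y`, the segment `[y, x]` can be prolonged
    -- slightly beyond `x`.
    have hev : ∀ᶠ ε : ℝ in nhdsWithin 0 (Set.Ioi 0), ∀ s ∈ S, ⟪s.1, x + ε • (x - y)⟫ ≤ s.2 := by
      rw [Filter.eventually_all_finset]
      intro s hs
      by_cases h : ⟪s.1, x⟫ = s.2
      · have h' : ⟪s.1, y⟫ = s.2 := by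
          have : s ∈ S.filter fun s => ⟪s.1, y⟫ = s.2 := by
            rw [← show S.filter (fun s => ⟪s.1, x⟫ = s.2) = S.filter fun s => ⟪s.1, y⟫ = s.2 from hxy]
            exact Finset.mem_filter.2 ⟨hs, h⟩
          exact (Finset.mem_filter.1 this).2
        refine Filter.Eventually.of_forall fun ε => ?_
        rw [inner_add_right, inner_smul_right, inner_sub_right, h, h']
        simp
      · have hlt : ⟪s.1, x⟫ < s.2 := lt_of_le_of_ne (hx.1 s hs) h
        have hc : ContinuousAt (fun ε : ℝ => ⟪s.1, x + ε • (x - y)⟫) 0 := by fun_prop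
        have : ∀ᶠ ε : ℝ in nhds 0, ⟪s.1, x + ε • (x - y)⟫ < s.2 :=
          hc.eventually_lt continuousAt_const (by simpa using hlt)
        exact (this.filter_mono nhdsWithin_le_nhds).mono fun ε h => h.le
    obtain ⟨ε, hε, hpos⟩ := (hev.and self_mem_nhdsWithin).exists
    have hpos : (0 : ℝ) < ε := hpos
    have hseg : x ∈ openSegment ℝ (x + ε • (x - y)) y := by
      refine ⟨1 / (1 + ε), ε / (1 + ε), by positivity, by positivity, by field_simp, ?_⟩
      have h1 : (1 + ε) ≠ 0 := by positivity
      have h2 : (1 / (1 + ε)) • (x + ε • (x - y)) + (ε / (1 + ε)) • y =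
          (1 / (1 + ε) * (1 + ε)) • x := by module
      rw [h2, one_div_mul_cancel h1, one_smul]
    have := (mem_extremePoints.1 hx).2 _ hε _ hy.1 hseg
    exact this.2.symm

theorem IsPolytope.convexHull_extremePoints {P : Set 𝔼} (hP : IsPolytope P) :
    convexHull ℝ (P.extremePoints ℝ) = P := by
  have h := closure_convexHull_extremePoints hP.1 hP.convex
  rwa [(hP.finite_extremePoints.isCompact_convexHull ℝ).isClosed.closure_eq] at h

theorem IsPolytope.inter_le {P : Set 𝔼} (hP : IsPolytope P) (l : StrongDual ℝ 𝔼) (c : ℝ) :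
    IsPolytope {x ∈ P | l x ≤ c} := by
  classical
  refine ⟨hP.1.inter_right (isClosed_le l.continuous continuous_const), ?_⟩
  obtain ⟨-, S, rfl⟩ := hP
  refine ⟨insert ((InnerProductSpace.toDual ℝ 𝔼).symm l, c) S, ?_⟩
  ext x
  simp only [Set.mem_ofPred_eq, Finset.forall_mem_insert, InnerProductSpace.toDual_symm_apply]
  tauto

theorem IsPolytope.inter_eq {P : Set 𝔼} (hP : IsPolytope P) (l : StrongDual ℝ 𝔼) (c : ℝ) :
    IsPolytope {x ∈ P | l x = c} := by
  have h := (hP.inter_le l c).inter_le (-l) (-c)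
  convert h using 1
  ext x
  simp only [Set.mem_ofPred_eq, neg_apply, neg_le_neg_iff, and_assoc]
  exact and_congr_right fun _ => le_antisymm_iff

theorem IsPolytope.le_of_extremePoints {P : Set 𝔼} (hP : IsPolytope P) (l : StrongDual ℝ 𝔼) (c : ℝ)
    (h : ∀ x ∈ P.extremePoints ℝ, l x ≤ c) : ∀ x ∈ P, l x ≤ c := by
  intro x hx
  rw [← hP.convexHull_extremePoints] at hx
  exact convexHull_min (t := {x | l x ≤ c}) h (convex_halfSpace_le l.isLinear c) hx

theorem IsFace.exists_max {P F : Set 𝔼} (h : IsFace P F) (hF : F.Nonempty) :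
    ∃ (l : StrongDual ℝ 𝔼) (M : ℝ), (∀ x ∈ P, l x ≤ M) ∧ F = {x ∈ P | l x = M} := by
  obtain ⟨l, rfl⟩ := h hF
  obtain ⟨w, hw⟩ := hF
  refine ⟨l, l w, hw.2, Set.Subset.antisymm ?_ ?_⟩
  · exact fun x hx => ⟨hx.1, le_antisymm (hw.2 x hx.1) (hx.2 w hw.1)⟩
  · exact fun x hx => ⟨hx.1, fun y hy => (hw.2 y hy).trans hx.2.ge⟩

theorem isFace_of_max {P : Set 𝔼} (l : StrongDual ℝ 𝔼) (M : ℝ) (h : ∀ x ∈ P, l x ≤ M) :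
    IsFace P {x ∈ P | l x = M} := by
  rintro ⟨w, hw⟩
  refine ⟨l, Set.Subset.antisymm ?_ ?_⟩
  · exact fun x hx => ⟨hx.1, fun y hy => (h y hy).trans hx.2.ge⟩
  · exact fun x hx => ⟨hx.1, le_antisymm (h x hx.1) (hw.2.symm.le.trans (hx.2 w hw.1))⟩

theorem IsFace.isPolytope {P F : Set 𝔼} (hP : IsPolytope P) (h : IsFace P F) (hF : F.Nonempty) :
    IsPolytope F := by
  obtain ⟨l, M, -, rfl⟩ := h.exists_max hF
  exact hP.inter_eq l M

theorem isFace_self (P : Set 𝔼) : IsFace P P := IsExposed.refl P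

theorem isFace_empty (P : Set 𝔼) : IsFace P ∅ := isExposed_empty

theorem finite_setOf_isFace {P : Set 𝔼} (hP : IsPolytope P) : {F | IsFace P F}.Finite := by
  refine (hP.finite_extremePoints.finite_subsets.image fun V => convexHull ℝ V).subset ?_
  intro F hF
  refine ⟨F ∩ P.extremePoints ℝ, Set.inter_subset_right, ?_⟩
  rcases F.eq_empty_or_nonempty with rfl | hne
  · simp
  · have hF' : IsPolytope F := IsFace.isPolytope hP hF hne
    rw [← (IsExposed.isExtreme hF).extremePoints_eq]
    exact hF'.convexHull_extremePoints

/-- Rotating a supporting hyperplane: if `u ≤ b` on the slice `q = a` of a polytope that has points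
with `q > a`, then for the largest slope `μ` of `u - b` against `q - a` over the part `q > a`, the
inequality `u - b ≤ μ (q - a)` holds on the whole polytope and is tight somewhere in that part. -/
theorem exists_tilt {C : Set 𝔼} (hC : IsPolytope C) (q u : StrongDual ℝ 𝔼) (a b : ℝ)
    (hpos : ∃ x ∈ C, a < q x) (hu : ∀ x ∈ C, q x = a → u x ≤ b) :
    ∃ μ : ℝ, (∀ x ∈ C, u x - b ≤ μ * (q x - a)) ∧
      ∃ x ∈ C, a < q x ∧ u x - b = μ * (q x - a) := by
  set V := C.extremePoints ℝ
  have hVC : V ⊆ C := extremePoints_subset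
  have hVpos : ({x ∈ V | a < q x}).Nonempty := by
    by_contra hne
    obtain ⟨x, hx, hax⟩ := hpos
    refine absurd (hC.le_of_extremePoints q a (fun y hy => ?_) x hx) (not_le.2 hax)
    by_contra hy'
    exact hne ⟨y, hy, not_le.1 hy'⟩
  obtain ⟨x, ⟨hxV, hxq⟩, hmax⟩ := Set.exists_max_image {x ∈ V | a < q x}
    (fun x => (u x - b) / (q x - a)) (hC.finite_extremePoints.subset fun x hx => hx.1) hVpos
  set μ := (u x - b) / (q x - a)
  have hxμ : u x - b = μ * (q x - a) := by
    rw [div_mul_cancel₀]; exact (sub_pos.2 hxq).ne'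
  refine ⟨μ, ?_, x, hVC hxV, hxq, hxμ⟩
  have key : ∀ y ∈ C, (u - μ • q) y ≤ b - μ * a := by
    refine hC.le_of_extremePoints _ _ fun y hy => ?_
    simp only [sub_apply, smul_apply, smul_eq_mul]
    rcases lt_trichotomy (q y) a with h | h | h
    · -- The segment from `x` to `y` crosses the slice, where the inequality is known.
      set t := (a - q y) / (q x - q y) with ht
      have hden : 0 < q x - q y := by linarith
      have ht0 : 0 < t := div_pos (by linarith) hden
      have ht1 : t < 1 := by rw [ht, div_lt_one hden]; linarith
      have htq : t * (q x - q y) = a - q y := by rw [ht, div_mul_cancel₀ _ hden.ne']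
      have hz : t • x + (1 - t) • y ∈ C :=
        hC.convex (hVC hxV) (hVC hy) ht0.le (by linarith) (by ring)
      have hqz : q (t • x + (1 - t) • y) = a := by
        simp only [map_add, map_smul, smul_eq_mul]; linarith
      have huz := hu _ hz hqz
      simp only [map_add, map_smul, smul_eq_mul] at huz
      have : (1 - t) * (u y - b - μ * (q y - a)) ≤ 0 := by
        have e : t * (u x - b - μ * (q x - a)) = 0 := by rw [hxμ]; ring
        have e2 : t * q x + (1 - t) * q y = a := by linarith
        have e3 : t * (q x - a) + (1 - t) * (q y - a) = 0 := by linarith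
        have e4 : μ * (t * (q x - a) + (1 - t) * (q y - a)) = 0 := by rw [e3, mul_zero]
        linarith
      have h2 : u y - b - μ * (q y - a) ≤ 0 := by
        by_contra hcon
        exact absurd this (not_le.2 (mul_pos (by linarith) (not_le.1 hcon)))
      linarith
    · have := hu y (hVC hy) h
      rw [h]; linarith
    · have h1 := hmax y ⟨hy, h⟩
      have h1 : (u y - b) / (q y - a) ≤ μ := h1
      rw [div_le_iff₀ (sub_pos.2 h)] at h1
      linarith
  intro y hy
  have := key y hy
  simp only [sub_apply, smul_apply, smul_eq_mul] at this
  linarith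

/-- For a polytope, being an exposed face is a transitive relation. -/
theorem IsFace.trans {P F F' : Set 𝔼} (hP : IsPolytope P) (h : IsFace P F) (h' : IsFace F F') :
    IsFace P F' := by
  rcases F'.eq_empty_or_nonempty with rfl | hF'
  · exact isFace_empty P
  obtain ⟨l, M, hM, hF⟩ := h.exists_max (hF'.mono h'.subset)
  obtain ⟨u, β, hβ, hF'⟩ := h'.exists_max hF'
  -- A functional exposing `F` in `P`, taken with a large multiplicity, is perturbed by a
  -- functional exposing `F'` in `F`.
  have hμ : ∃ μ : ℝ, ∀ x ∈ P, u x - β ≤ μ * (M - l x) := by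
    by_cases hpos : ∃ x ∈ P, -M < (-l) x
    · obtain ⟨μ, h1, -⟩ := exists_tilt hP (-l) u (-M) β hpos (fun x hx hlx => hβ x (by
        rw [hF]; exact ⟨hx, by simpa using hlx⟩))
      exact ⟨μ, fun x hx => (h1 x hx).trans_eq (by rw [neg_apply]; ring)⟩
    · push Not at hpos
      refine ⟨0, fun x hx => ?_⟩
      have : x ∈ F := by
        rw [hF]; exact ⟨hx, le_antisymm (hM x hx) (by simpa using hpos x hx)⟩
      linarith [hβ x this]
  obtain ⟨μ, hμ⟩ := hμ
  have hmax : ∀ x ∈ P, ((μ + 1) • l + u) x ≤ (μ + 1) * M + β := by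
    intro x hx
    have h1 := hμ x hx
    have h2 := hM x hx
    simp only [add_apply, smul_apply, smul_eq_mul]
    linarith
  convert isFace_of_max _ _ hmax using 1
  ext x
  simp only [hF', hF, Set.mem_ofPred_eq, add_apply,
    smul_apply, smul_eq_mul]
  constructor
  · rintro ⟨⟨hx, h1⟩, h2⟩
    exact ⟨hx, by rw [h1, h2]⟩
  · rintro ⟨hx, h1⟩
    have h2 := hμ x hx
    have h3 := hM x hx
    have h4 : l x = M := by linarith
    refine ⟨⟨hx, h4⟩, ?_⟩
    rw [h4] at h1; linarith

/-- A face of `P` contained in a face `C` of `P` is a face of `C`. -/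
theorem IsFace.of_subset {P F C : Set 𝔼} (h : IsFace P F) (hC : IsFace P C) (hFC : F ⊆ C) :
    IsFace C F :=
  IsExposed.mono h hC.subset hFC

/-! ### Dimension and facets -/

theorem dim_empty : dim (∅ : Set 𝔼) = -1 := by simp [dim]

theorem dim_of_nonempty {A : Set 𝔼} (h : A.Nonempty) :
    dim A = (Module.finrank ℝ (vectorSpan ℝ A) : ℤ) := by simp [dim, h]

theorem neg_one_le_dim (A : Set 𝔼) : -1 ≤ dim A := by
  unfold dim; split_ifs <;> omega

theorem nonempty_of_dim_nonneg {A : Set 𝔼} (h : 0 ≤ dim A) : A.Nonempty := by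
  by_contra hA
  rw [Set.not_nonempty_iff_eq_empty.1 hA, dim_empty] at h
  omega

theorem dim_nonneg {A : Set 𝔼} (h : A.Nonempty) : 0 ≤ dim A := by
  rw [dim_of_nonempty h]; omega

theorem dim_mono {A B : Set 𝔼} (h : A ⊆ B) : dim A ≤ dim B := by
  rcases A.eq_empty_or_nonempty with rfl | hA
  · rw [dim_empty]; exact neg_one_le_dim B
  · rw [dim_of_nonempty hA, dim_of_nonempty (hA.mono h)]
    exact_mod_cast Submodule.finrank_mono (vectorSpan_mono ℝ h)

theorem vectorSpan_le_ker {A : Set 𝔼} (q : StrongDual ℝ 𝔼) (a : ℝ) (h : ∀ x ∈ A, q x = a) :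
    vectorSpan ℝ A ≤ LinearMap.ker q.toLinearMap := by
  refine Submodule.span_le.2 ?_
  rintro _ ⟨x, hx, y, hy, rfl⟩
  simp [h x hx, h y hy]

theorem dim_add_one_le {A B : Set 𝔼} (hAB : A ⊆ B) (q : StrongDual ℝ 𝔼) (a : ℝ)
    (hA : ∀ x ∈ A, q x = a) (hB : ∃ x ∈ B, q x ≠ a) : dim A + 1 ≤ dim B := by
  obtain ⟨y, hy, hqy⟩ := hB
  rcases A.eq_empty_or_nonempty with rfl | ⟨p, hp⟩
  · rw [dim_empty]; simpa using dim_nonneg ⟨y, hy⟩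
  · rw [dim_of_nonempty ⟨p, hp⟩, dim_of_nonempty ⟨y, hy⟩]
    have hlt : vectorSpan ℝ A < vectorSpan ℝ B := by
      refine lt_of_le_of_ne (vectorSpan_mono ℝ hAB) fun h => hqy ?_
      have h1 : y -ᵥ p ∈ vectorSpan ℝ A := h ▸ vsub_mem_vectorSpan ℝ hy (hAB hp)
      have h2 := vectorSpan_le_ker q a hA h1
      have h3 : q y - q p = 0 := by simpa using h2
      rw [hA p hp] at h3
      linarith
    exact_mod_cast Submodule.finrank_lt_finrank_of_lt hlt

theorem dim_singleton (x : 𝔼) : dim {x} = 0 := by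
  rw [dim_of_nonempty (Set.singleton_nonempty x), vectorSpan_singleton]; simp

theorem eq_of_dim_eq_zero {A : Set 𝔼} (h : dim A = 0) {x y : 𝔼} (hx : x ∈ A) (hy : y ∈ A) :
    x = y := by
  by_contra hne
  have := dim_add_one_le (A := {x}) (B := A) (by simpa using hx) (innerSL ℝ (y - x))
    (innerSL ℝ (y - x) x) (by simp) ⟨y, hy, fun h => hne ?_⟩
  · rw [dim_singleton] at this; omega
  · rw [← sub_eq_zero, ← map_sub, innerSL_apply_apply, inner_self_eq_zero, sub_eq_zero] at h
    exact h.symm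

/-- A face is cut out by its own affine span, so a larger subset of `P` has larger dimension. -/
theorem IsFace.eq_of_dim_le {P A B : Set 𝔼} (hA : IsFace P A) (hAB : A ⊆ B) (hB : B ⊆ P)
    (h : dim B ≤ dim A) : A = B := by
  rcases A.eq_empty_or_nonempty with rfl | hne
  · rcases B.eq_empty_or_nonempty with rfl | hB'
    · rfl
    · have := dim_nonneg hB'; rw [dim_empty] at h; omega
  · obtain ⟨l, M, -, hA'⟩ := hA.exists_max hne
    refine hAB.antisymm fun x hx => ?_
    by_contra hxA
    have := dim_add_one_le hAB l M (fun y hy => by rw [hA'] at hy; exact hy.2)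
      ⟨x, hx, fun h => hxA (by rw [hA']; exact ⟨hB hx, h⟩)⟩
    omega

/-- An affine functional constant on a facet `A` of `B` and not constant on `B` attains a strict
extremum over `B` exactly on `A`. -/
theorem facet_sign {P A B : Set 𝔼} (hA : IsFace P A) (hne : A.Nonempty) (hAB : A ⊆ B)
    (hB : B ⊆ P) (hdim : dim B = dim A + 1) (q : StrongDual ℝ 𝔼) (a : ℝ)
    (hqA : ∀ x ∈ A, q x = a) (hqB : ∃ x ∈ B, q x ≠ a) :
    (∀ x ∈ B, x ∉ A → a < q x) ∨ (∀ x ∈ B, x ∉ A → q x < a) := by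
  obtain ⟨l, M, hM, hA'⟩ := hA.exists_max hne
  obtain ⟨y, hy, hqy⟩ := hqB
  have hlt : ∀ x ∈ B, x ∉ A → l x < M := fun x hx hxA =>
    lt_of_le_of_ne (hM x (hB hx)) fun h => hxA (by rw [hA']; exact ⟨hB hx, h⟩)
  have hlA : ∀ x ∈ A, l x = M := fun x hx => by rw [hA'] at hx; exact hx.2
  have hyA : y ∉ A := fun h => hqy (hqA y h)
  have hly := hlt y hy hyA
  -- Otherwise `A`, `A ∪ {y}` and `B` would have three different dimensions.
  have key : ∀ x ∈ B, (q x - a) * (M - l y) = (q y - a) * (M - l x) := by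
    by_contra hcon
    push Not at hcon
    obtain ⟨x, hx, hxne⟩ := hcon
    have h1 : dim A + 1 ≤ dim (insert y A) :=
      dim_add_one_le (Set.subset_insert y A) l M hlA ⟨y, Set.mem_insert y A, hly.ne⟩
    have h2 : dim (insert y A) + 1 ≤ dim B := by
      refine dim_add_one_le (Set.insert_subset hy hAB) ((M - l y) • q + (q y - a) • l)
        ((M - l y) * a + (q y - a) * M) ?_ ⟨x, hx, fun h => hxne ?_⟩
      · rintro z (rfl | hz)
        · simp only [add_apply, smul_apply, smul_eq_mul]; ring
        · simp only [add_apply, smul_apply, smul_eq_mul, hqA z hz, hlA z hz]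
      · simp only [add_apply, smul_apply, smul_eq_mul] at h
        linarith
    omega
  rcases lt_or_gt_of_ne hqy with h | h
  · right
    intro x hx hxA
    have h1 := key x hx
    have h2 := hlt x hx hxA
    have h3 : (q x - a) * (M - l y) < 0 := by
      rw [h1]; exact mul_neg_of_neg_of_pos (by linarith) (by linarith)
    nlinarith
  · left
    intro x hx hxA
    have h1 := key x hx
    have h2 := hlt x hx hxA
    have h3 : 0 < (q x - a) * (M - l y) := by
      rw [h1]; exact mul_pos (by linarith) (by linarith)
    nlinarith

theorem IsFace.dim_lt {P A : Set 𝔼} (hA : IsFace P A) (hne : A ≠ P) : dim A < dim P := by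
  by_contra h
  exact hne (hA.eq_of_dim_le hA.subset le_rfl (not_lt.1 h))

/-- A face of codimension at least two is contained in a larger proper face: its supporting hyperplane
is tilted, by a functional `u` that is constant on the face and one further point `y` of the polytope
but not on the whole polytope, until it reaches a new point. -/
theorem exists_larger_face {C D : Set 𝔼} (hC : IsPolytope C) (hD : IsFace C D)
    (h : dim D + 1 < dim C) : ∃ D', IsFace C D' ∧ D ⊆ D' ∧ dim D < dim D' ∧ dim D' < dim C := by
  rcases D.eq_empty_or_nonempty with rfl | ⟨p, hp⟩
  · rw [dim_empty] at h
    obtain ⟨x, hx⟩ := nonempty_of_dim_nonneg (A := C) (by omega)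
    obtain ⟨y, hy, hyx⟩ : ∃ y ∈ C, y ≠ x := by
      by_contra hcon
      push Not at hcon
      have : C = {x} := Set.Subset.antisymm hcon (by simpa using hx)
      rw [this, dim_singleton] at h; omega
    set u := innerSL ℝ (y - x)
    have hu : u y ≠ u x := fun h => hyx (by
      rwa [← sub_eq_zero, ← map_sub, innerSL_apply_apply, inner_self_eq_zero, sub_eq_zero] at h)
    obtain ⟨z, hz, hmax⟩ := hC.1.exists_isMaxOn ⟨x, hx⟩ u.continuous.continuousOn
    refine ⟨{w ∈ C | u w = u z}, isFace_of_max u (u z) hmax, Set.empty_subset _, ?_, ?_⟩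
    · rw [dim_empty]
      exact lt_of_lt_of_le (by omega) (dim_nonneg ⟨z, hz, rfl⟩)
    · refine (isFace_of_max u (u z) hmax).dim_lt fun heq => hu ?_
      rw [← heq] at hx hy
      rw [hx.2, hy.2]
  · obtain ⟨l, M, hM, hD'⟩ := hD.exists_max ⟨p, hp⟩
    have hlD : ∀ x ∈ D, l x = M := fun x hx => by rw [hD'] at hx; exact hx.2
    obtain ⟨y, hy, hyD⟩ : ∃ y ∈ C, y ∉ D := by
      by_contra hcon
      push Not at hcon
      have := dim_mono hcon
      omega
    have hly : l y < M := lt_of_le_of_ne (hM y hy) fun h => hyD (by rw [hD']; exact ⟨hy, h⟩)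
    -- A functional constant on `D ∪ {y}` but not on `C`.
    obtain ⟨u, hupy, huD, w, hw, huw⟩ : ∃ u : StrongDual ℝ 𝔼, u y = u p ∧ (∀ x ∈ D, u x = u p) ∧
        ∃ w ∈ C, u w ≠ u p := by
      set W : Submodule ℝ 𝔼 := vectorSpan ℝ D ⊔ Submodule.span ℝ {y - p}
      have hlt : Module.finrank ℝ W < Module.finrank ℝ (vectorSpan ℝ C) := by
        have h1 : Module.finrank ℝ W ≤ _ := Submodule.finrank_add_le_finrank_add_finrank
          (vectorSpan ℝ D) (Submodule.span ℝ {y - p})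
        have h2 : Module.finrank ℝ (Submodule.span ℝ {y - p}) ≤ 1 :=
          (finrank_span_le_card ({y - p} : Set 𝔼)).trans (by simp)
        rw [dim_of_nonempty ⟨p, hp⟩, dim_of_nonempty ⟨y, hy⟩] at h
        omega
      obtain ⟨v, hv, hvW⟩ : ∃ v ∈ vectorSpan ℝ C, v ∉ W := by
        by_contra hcon
        push Not at hcon
        exact absurd (Submodule.finrank_mono hcon) (not_le.2 hlt)
      obtain ⟨f, hfv, hf⟩ := Submodule.exists_le_ker_of_notMem hvW
      have hcont : ∀ x, LinearMap.toContinuousLinearMap f x = f x := fun x => rfl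
      refine ⟨LinearMap.toContinuousLinearMap f, ?_, ?_, ?_⟩
      · have : y - p ∈ W := Submodule.mem_sup_right (Submodule.mem_span_singleton_self _)
        have := hf this
        rw [LinearMap.mem_ker, map_sub, sub_eq_zero] at this
        exact this
      · intro x hx
        have : x - p ∈ W := Submodule.mem_sup_left (vsub_mem_vectorSpan ℝ hx hp)
        have := hf this
        rw [LinearMap.mem_ker, map_sub, sub_eq_zero] at this
        exact this
      · by_contra hcon
        push Not at hcon
        exact hfv (vectorSpan_le_ker _ _ hcon hv)
    obtain ⟨μ, hμ, x, hx, hqx, hxμ⟩ := exists_tilt hC (-l) u (-M) (u p) ⟨y, hy, by simpa using hly⟩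
      (fun x hx hlx => (huD x (by rw [hD']; exact ⟨hx, by simpa using hlx⟩)).le)
    have hmax : ∀ z ∈ C, (u + μ • l) z ≤ u p + μ * M := by
      intro z hz
      have := hμ z hz
      simp only [add_apply, smul_apply, smul_eq_mul, neg_apply] at this ⊢
      linarith
    have hface := isFace_of_max _ _ hmax
    have hsub : D ⊆ {z ∈ C | (u + μ • l) z = u p + μ * M} := fun z hz => ⟨hD.subset hz, by
      simp only [add_apply, smul_apply, smul_eq_mul, huD z hz, hlD z hz]⟩
    refine ⟨_, hface, hsub, ?_, hface.dim_lt fun heq => huw ?_⟩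
    · have := dim_add_one_le hsub l M hlD ⟨x, ⟨hx, ?_⟩, ?_⟩
      · omega
      · simp only [add_apply, smul_apply, smul_eq_mul, neg_apply] at hxμ ⊢
        linarith
      · rw [neg_apply] at hqx
        exact fun h => absurd hqx (by rw [h]; exact lt_irrefl _)
    · have hy' := hy
      rw [← heq] at hy' hw
      -- If the new face were everything, evaluation at `y` would give `μ = 0`.
      have e1 := hy'.2
      have e2 := hw.2
      simp only [add_apply, smul_apply, smul_eq_mul, hupy] at e1 e2
      have h0 : μ * (M - l y) = 0 := by linarith
      rcases mul_eq_zero.1 h0 with h0 | h0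
      · rw [h0] at e2; linarith
      · linarith

theorem exists_facet {C D : Set 𝔼} (hC : IsPolytope C) (hD : IsFace C D)
    (h : dim D + 1 ≤ dim C) : ∃ Y, IsFace C Y ∧ D ⊆ Y ∧ dim Y + 1 = dim C := by
  induction hk : (dim C - dim D).toNat using Nat.strong_induction_on generalizing D with
  | _ k ih =>
    rcases h.eq_or_lt with h | h
    · exact ⟨D, hD, subset_rfl, h⟩
    · obtain ⟨D', hD', hDD', h1, h2⟩ := exists_larger_face hC hD h
      obtain ⟨Y, hY, hDY, hdim⟩ := ih (dim C - dim D').toNat (by omega) hD' (by omega) rfl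
      exact ⟨Y, hY, hDD'.trans hDY, hdim⟩

/-! ### Coordinate sections -/

/-- The orthogonal projection onto the `i`-th coordinate hyperplane: the `i`-th coordinate is
replaced by `0`. -/
noncomputable def drop (i : Fin d) (x : 𝔼) : 𝔼 := x - x i • EuclideanSpace.single i 1

/-- The `i`-th coordinate hyperplane. -/
def hyp (i : Fin d) : Set 𝔼 := {x | x i = 0}

@[simp] theorem mem_hyp {i : Fin d} {x : 𝔼} : x ∈ hyp i ↔ x i = 0 := Iff.rfl

theorem drop_apply (i j : Fin d) (x : 𝔼) : drop i x j = if j = i then 0 else x j := by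
  by_cases h : j = i
  · subst h; simp [drop]
  · simp [drop, h]

@[simp] theorem drop_apply_self (i : Fin d) (x : 𝔼) : drop i x i = 0 := by simp [drop_apply]

theorem drop_apply_of_ne {i j : Fin d} (h : j ≠ i) (x : 𝔼) : drop i x j = x j := by
  simp [drop_apply, h]

theorem map_drop (l : StrongDual ℝ 𝔼) (i : Fin d) (x : 𝔼) :
    l (drop i x) = l x - x i * l (EuclideanSpace.single i 1) := by simp [drop]

/-- The `i`-th coordinate as a continuous linear functional. -/
noncomputable def coord (i : Fin d) : StrongDual ℝ 𝔼 := EuclideanSpace.proj i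

@[simp] theorem coord_apply (i : Fin d) (x : 𝔼) : coord i x = x i := rfl

theorem map_eq_sum (l : StrongDual ℝ 𝔼) (x : 𝔼) :
    l x = ∑ i, x i * l (EuclideanSpace.single i 1) := by
  conv_lhs => rw [← (EuclideanSpace.basisFun (Fin d) ℝ).sum_repr x]
  simp

/-- The properties of the section of a normalized locally anti-blocking polytope by the coordinate
subspace with index set `J` on which the argument depends. -/
structure IsBlock (P : Set 𝔼) (J : Finset (Fin d)) : Prop where
  polytope : IsPolytope P
  drop_mem : ∀ i, ∀ x ∈ P, drop i x ∈ P
  single_mem : ∀ i ∈ J, ∀ s : ℝ, s = 1 ∨ s = -1 → EuclideanSpace.single i s ∈ P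
  support : ∀ x ∈ P, ∀ i ∉ J, x i = 0
  abs_le : ∀ x ∈ P, ∀ i, |x i| ≤ 1
  zero_mem : (0 : 𝔼) ∈ P

theorem IsBlock.inter_hyp {P : Set 𝔼} {J : Finset (Fin d)} (h : IsBlock P J) (i : Fin d) :
    IsBlock (P ∩ hyp i) (J.erase i) where
  polytope := h.polytope.inter_eq (coord i) 0
  drop_mem := by
    rintro j x ⟨hx, hxi⟩
    refine ⟨h.drop_mem j x hx, ?_⟩
    rw [mem_hyp] at *
    rw [drop_apply, hxi, ite_self]
  single_mem := by
    intro j hj s hs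
    rw [Finset.mem_erase] at hj
    exact ⟨h.single_mem j hj.2 s hs, by simp [hj.1.symm]⟩
  support := by
    rintro x ⟨hx, hxi⟩ j hj
    by_cases hji : j = i
    · rw [hji]; exact hxi
    · exact h.support x hx j fun hJ => hj (Finset.mem_erase.2 ⟨hji, hJ⟩)
  abs_le := fun x hx => h.abs_le x hx.1
  zero_mem := ⟨h.zero_mem, by simp⟩

theorem IsBlock.card_le_dim {P : Set 𝔼} {J : Finset (Fin d)} (h : IsBlock P J) :
    (J.card : ℤ) ≤ dim P := by
  induction hn : J.card generalizing P J with
  | zero => simpa using dim_nonneg ⟨0, h.zero_mem⟩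
  | succ n ih =>
    obtain ⟨i, hi⟩ := Finset.card_pos.1 (by omega : 0 < J.card)
    have h1 := ih (h.inter_hyp i) (by rw [Finset.card_erase_of_mem hi]; omega)
    have h2 := dim_add_one_le (A := P ∩ hyp i) (B := P) Set.inter_subset_left (coord i) 0
      (fun x hx => hx.2) ⟨_, h.single_mem i hi 1 (Or.inl rfl), by simp⟩
    push_cast
    omega

theorem dim_le_card {A : Set 𝔼} {J : Finset (Fin d)} (h : ∀ x ∈ A, ∀ i ∉ J, x i = 0) :
    dim A ≤ J.card := by
  classical
  rcases A.eq_empty_or_nonempty with rfl | hA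
  · rw [dim_empty]; omega
  rw [dim_of_nonempty hA]
  set S : Finset 𝔼 := J.image fun j => EuclideanSpace.single j (1 : ℝ)
  have hle : vectorSpan ℝ A ≤ Submodule.span ℝ (S : Set 𝔼) := by
    refine Submodule.span_le.2 ?_
    rintro _ ⟨x, hx, y, hy, rfl⟩
    have hz : ∀ z ∈ A, z ∈ Submodule.span ℝ (S : Set 𝔼) := by
      intro z hz
      have : z = ∑ j, z j • EuclideanSpace.single j (1 : ℝ) := by
        conv_lhs => rw [← (EuclideanSpace.basisFun (Fin d) ℝ).sum_repr z]
        simp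
      rw [this]
      refine Submodule.sum_mem _ fun j _ => ?_
      by_cases hj : j ∈ J
      · exact Submodule.smul_mem _ _ (Submodule.subset_span
          (Finset.mem_coe.2 (Finset.mem_image_of_mem _ hj)))
      · rw [h z hz j hj, zero_smul]; exact Submodule.zero_mem _
    exact Submodule.sub_mem _ (hz x hx) (hz y hy)
  have h1 := Submodule.finrank_mono hle
  have h2 := (finrank_span_finset_le_card (R := ℝ) S).trans Finset.card_image_le
  exact_mod_cast h1.trans h2

theorem IsBlock.dim_eq {P : Set 𝔼} {J : Finset (Fin d)} (h : IsBlock P J) : dim P = J.card :=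
  le_antisymm (dim_le_card h.support) h.card_le_dim

/-- If a face contains a segment in direction `e i`, or lies on both sides of the `i`-th coordinate
hyperplane, then its exposing functionals do not depend on the `i`-th coordinate. -/
theorem IsFace.drop_mem {P F : Set 𝔼} {i : Fin d} (hP : ∀ x ∈ P, drop i x ∈ P) (hF : IsFace P F)
    (h : (∃ x ∈ F, drop i x ∈ F ∧ x i ≠ 0) ∨ ∃ x ∈ F, ∃ z ∈ F, 0 < x i ∧ z i < 0) :
    ∀ y ∈ F, drop i y ∈ F := by
  intro y hy
  obtain ⟨l, M, hM, rfl⟩ := hF.exists_max ⟨y, hy⟩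
  have h0 : l (EuclideanSpace.single i 1) = 0 := by
    rcases h with ⟨x, hx, hx', hxi⟩ | ⟨x, hx, z, hz, hxi, hzi⟩
    · have := hx'.2
      rw [map_drop, hx.2, sub_eq_self] at this
      exact (mul_eq_zero.1 this).resolve_left hxi
    · have h1 := hM _ (hP x hx.1)
      have h2 := hM _ (hP z hz.1)
      rw [map_drop, hx.2] at h1
      rw [map_drop, hz.2] at h2
      nlinarith
  refine ⟨hP y hy.1, ?_⟩
  rw [map_drop, h0, mul_zero, sub_zero]
  exact hy.2

/-! ### Full chains of faces and walls -/

/-- The chains `F 0 ⊂ F 1 ⊂ … ⊂ F n` of faces of `P` with `dim (F k) = k`. The values `F k` for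
`k > n` are irrelevant and are set to `∅`. -/
def fullChains (P : Set 𝔼) (n : ℕ) : Set (ℕ → Set 𝔼) :=
  {F | (∀ k ≤ n, IsFace P (F k) ∧ dim (F k) = k) ∧ (∀ k < n, F k ⊆ F (k + 1)) ∧
    ∀ k, n < k → F k = ∅}

/-- `B` is a wall over `A` if, for some coordinate direction `e i`, `A` lies in the `i`-th coordinate
hyperplane, `B` does not, and `B` contains the projection of each of its points to that hyperplane.
When `A` is a facet of `B`, the set `B` then stands on `A` in direction `e i` on one side of the
hyperplane. -/
def IsWall (A B : Set 𝔼) : Prop :=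
  ∃ i, A ⊆ hyp i ∧ (∃ x ∈ B, x i ≠ 0) ∧ ∀ x ∈ B, drop i x ∈ B

/-- The full chains of faces in which no member is a wall over the preceding one. -/
def wallFree (P : Set 𝔼) (n : ℕ) : Set (ℕ → Set 𝔼) :=
  {F | F ∈ fullChains P n ∧ ∀ k < n, ¬ IsWall (F k) (F (k + 1))}

theorem finite_fullChains {P : Set 𝔼} (hP : IsPolytope P) (n : ℕ) : (fullChains P n).Finite := by
  refine Set.Finite.of_finite_image (f := fun F => fun k : Fin (n + 1) => F k)
    ((Set.Finite.pi' fun _ => finite_setOf_isFace hP).subset ?_) ?_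
  · rintro _ ⟨F, hF, rfl⟩ k
    exact (hF.1 k (by omega)).1
  · intro F hF G hG h
    funext k
    by_cases hk : k ≤ n
    · exact congrFun h ⟨k, by omega⟩
    · rw [hF.2.2 k (by omega), hG.2.2 k (by omega)]

theorem finite_wallFree {P : Set 𝔼} (hP : IsPolytope P) (n : ℕ) : (wallFree P n).Finite :=
  (finite_fullChains hP n).subset fun _ hF => hF.1

theorem fullChains_top {P : Set 𝔼} {n : ℕ} (hdim : dim P = n) {F : ℕ → Set 𝔼}
    (hF : F ∈ fullChains P n) : F n = P :=
  (hF.1 n le_rfl).1.eq_of_dim_le (hF.1 n le_rfl).1.subset le_rfl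
    (by rw [hdim, (hF.1 n le_rfl).2])

theorem fullChains_nonempty {P : Set 𝔼} {n : ℕ} {F : ℕ → Set 𝔼} (hF : F ∈ fullChains P n) {k : ℕ}
    (hk : k ≤ n) : (F k).Nonempty :=
  nonempty_of_dim_nonneg (by rw [(hF.1 k hk).2]; omega)

theorem fullChains_subset {P : Set 𝔼} {n : ℕ} {F : ℕ → Set 𝔼} (hF : F ∈ fullChains P n) {j k : ℕ}
    (hjk : j ≤ k) (hk : k ≤ n) : F j ⊆ F k := by
  induction k, hjk using Nat.le_induction with
  | base => rfl
  | succ k hjk ih => exact (ih (by omega)).trans (hF.2.1 k (by omega))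

/-- Construction of a finite sequence from its last term downwards. -/
theorem exists_seq_below {α : Type*} (p : ℕ → α → Prop) (r : α → α → Prop) (N : ℕ) (a : α)
    (ha : p N a) (step : ∀ k < N, ∀ b, p (k + 1) b → ∃ c, p k c ∧ r c b) :
    ∃ F : ℕ → α, F N = a ∧ (∀ k ≤ N, p k (F k)) ∧ ∀ k < N, r (F k) (F (k + 1)) := by
  induction N generalizing a with
  | zero =>
    refine ⟨fun _ => a, rfl, fun k hk => ?_, fun k hk => absurd hk (by omega)⟩
    rwa [Nat.le_zero.1 hk]
  | succ N ih =>
    obtain ⟨c, hc, hca⟩ := step N (by omega) a ha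
    obtain ⟨F, hFN, hF, hr⟩ := ih c hc fun k hk => step k (by omega)
    refine ⟨fun k => if k ≤ N then F k else a, by simp, fun k hk => ?_, fun k hk => ?_⟩
    · by_cases h : k ≤ N
      · simpa [h] using hF k h
      · have hkN : k = N + 1 := by omega
        subst hkN
        simpa using ha
    · by_cases h : k + 1 ≤ N
      · simpa [h, show k ≤ N by omega] using hr k (by omega)
      · have : k = N := by omega
        subst this
        simpa [hFN] using hca

/-- Two consecutive members of a chain of faces extend to a full chain. -/
theorem exists_fullChain {P A B : Set 𝔼} {n a : ℕ} (hP : IsPolytope P) (hdim : dim P = n)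
    (hA : IsFace P A) (hB : IsFace P B) (hAB : A ⊆ B) (hdA : dim A = a) (hdB : dim B = a + 1) :
    a < n ∧ ∃ F ∈ fullChains P n, F a = A ∧ F (a + 1) = B := by
  have han : a < n := by
    have := dim_mono hB.subset
    omega
  refine ⟨han, ?_⟩
  obtain ⟨F, -, hF, hr⟩ := exists_seq_below
    (fun k X => IsFace P X ∧ dim X = k ∧ (a + 1 ≤ k → B ⊆ X) ∧ (a ≤ k → A ⊆ X)) (· ⊆ ·) n P
    ⟨isFace_self P, hdim, fun _ => hB.subset, fun _ => hA.subset⟩ (by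
      rintro k hk X ⟨hX, hdX, hBX, hAX⟩
      have hX' : IsPolytope X :=
        hX.isPolytope hP (nonempty_of_dim_nonneg (by rw [hdX]; omega))
      -- `T` is the largest of the prescribed faces that the next face has to contain.
      obtain ⟨T, hT, hTX, hdT, hBT, hAT⟩ : ∃ T, IsFace P T ∧ T ⊆ X ∧ dim T ≤ k ∧
          (a + 1 ≤ k → B ⊆ T) ∧ (a ≤ k → A ⊆ T) := by
        by_cases h1 : a + 1 ≤ k
        · exact ⟨B, hB, hBX (by omega), by omega, fun _ => subset_rfl, fun _ => hAB⟩
        · by_cases h2 : a ≤ k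
          · exact ⟨A, hA, hAX (by omega), by omega, fun h => absurd h h1, fun _ => subset_rfl⟩
          · exact ⟨∅, isFace_empty P, Set.empty_subset X, by rw [dim_empty]; omega,
              fun h => absurd h h1, fun h => absurd h h2⟩
      obtain ⟨Y, hY, hTY, hdY⟩ := exists_facet hX' (hT.of_subset hX hTX) (by
        rw [hdX]; push_cast; omega)
      exact ⟨Y, ⟨hX.trans hP hY, by push_cast at hdX; omega, fun h => (hBT h).trans hTY,
        fun h => (hAT h).trans hTY⟩, hY.subset⟩)
  refine ⟨fun k => if k ≤ n then F k else ∅, ⟨fun k hk => ?_, fun k hk => ?_, fun k hk => ?_⟩, ?_, ?_⟩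
  · simp only [hk, if_true]; exact ⟨(hF k hk).1, (hF k hk).2.1⟩
  · simp only [show k ≤ n by omega, show k + 1 ≤ n by omega, if_true]; exact hr k hk
  · simp [show ¬ k ≤ n by omega]
  · simp only [han.le, if_true]
    obtain ⟨h1, h2, -, h3⟩ := hF a han.le
    exact (hA.eq_of_dim_le (h3 le_rfl) h1.subset (by omega)).symm
  · simp only [show a + 1 ≤ n by omega, if_true]
    obtain ⟨h1, h2, h3, -⟩ := hF (a + 1) han
    exact (hB.eq_of_dim_le (h3 le_rfl) h1.subset (by push_cast at h2; omega)).symm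

/-! ### Lifting chains from a coordinate section -/

/-- The chain of sections of the members `F 1, F 2, …` of a chain by a coordinate hyperplane. -/
def sec (i : Fin d) (F : ℕ → Set 𝔼) : ℕ → Set 𝔼 := fun k => F (k + 1) ∩ hyp i

/-- The lift of a chain of faces of the section `P ∩ hyp i`. It is built from `P` downwards: the
hyperplane which cuts out the next face of the section is tilted about the section until it supports
the current face of `P` at a point with `s * x i > 0`. -/
theorem exists_lift {P : Set 𝔼} {J : Finset (Fin d)} {i : Fin d} {n : ℕ} (hB : IsBlock P J)
    (hi : i ∈ J) (hdim : dim P = n + 1) (hdim' : dim (P ∩ hyp i) = n) {s : ℝ}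
    (hs : s = 1 ∨ s = -1) {G : ℕ → Set 𝔼} (hG : G ∈ fullChains (P ∩ hyp i) n) :
    ∃ F ∈ fullChains P (n + 1), sec i F = G ∧ ∀ x ∈ F 0, 0 < s * x i := by
  have hs0 : s ≠ 0 := by rcases hs with rfl | rfl <;> norm_num
  have hP := hB.polytope
  obtain ⟨F, -, hF, hr⟩ := exists_seq_below
    (fun k X => IsFace P X ∧ dim X = k ∧ (X ∩ hyp i = if k = 0 then ∅ else G (k - 1)) ∧
      ∃ x ∈ X, 0 < s * x i) (· ⊆ ·) (n + 1) P
    ⟨isFace_self P, by push_cast; exact hdim, by simp [fullChains_top hdim' hG],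
      EuclideanSpace.single i s, hB.single_mem i hi s hs, by
        rcases hs with rfl | rfl <;> simp⟩ (by
      rintro k hk X ⟨hX, hdX, hXG, x, hx, hxi⟩
      have hX' : IsPolytope X := hX.isPolytope hP ⟨x, hx⟩
      simp only [Nat.add_eq_zero_iff, one_ne_zero, and_false, if_false, Nat.add_sub_cancel] at hXG
      rcases k with _ | k
      -- The vertex is the endpoint of the edge `X` on the prescribed side.
      · obtain ⟨z, hz, hmax⟩ := hX'.1.exists_isMaxOn ⟨x, hx⟩ (s • coord i).continuous.continuousOn
        have hzpos : 0 < s * z i := lt_of_lt_of_le hxi (hmax hx)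
        set Y : Set 𝔼 := {w ∈ X | (s • coord i : StrongDual ℝ 𝔼) w = s * z i}
        have hface : IsFace X Y := isFace_of_max (s • coord i) (s * z i) hmax
        have hlt := hface.dim_lt fun heq => by
          obtain ⟨w, hw⟩ := fullChains_nonempty hG (Nat.zero_le n)
          rw [← hXG, ← heq] at hw
          have h1 : s * w i = s * z i := hw.1.2
          rw [show w i = 0 from hw.2, mul_zero] at h1
          linarith
        refine ⟨Y, ⟨hX.trans hP hface, ?_, ?_, z, ⟨hz, rfl⟩, hzpos⟩, hface.subset⟩
        · have := dim_nonneg (A := Y) ⟨z, hz, rfl⟩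
          rw [hdX] at hlt
          push_cast at hlt ⊢
          omega
        · rw [if_pos rfl, Set.eq_empty_iff_forall_notMem]
          rintro w ⟨⟨-, hw⟩, hwi⟩
          have h1 : s * w i = s * z i := hw
          rw [show w i = 0 from hwi, mul_zero] at h1
          linarith
      · have hk' : k + 1 ≤ n := by omega
        have hkG := hG.1 k (by omega)
        have hkG' := hG.1 (k + 1) hk'
        have hsub := hG.2.1 k (by omega)
        obtain ⟨u, b, hub, hGk⟩ := (hkG.1.of_subset hkG'.1 hsub).exists_max
          (fullChains_nonempty hG (by omega : k ≤ n))
        obtain ⟨μ, hμ, z, hz, hzi, hzμ⟩ := exists_tilt hX' (s • coord i) u 0 b ⟨x, hx, hxi⟩ (by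
          intro w hw hwi
          refine hub w ?_
          rw [← hXG]
          exact ⟨hw, (mul_eq_zero.1 (show s * w i = 0 from hwi)).resolve_left hs0⟩)
        have hmax : ∀ w ∈ X, (u - μ • s • coord i) w ≤ b := by
          intro w hw
          have := hμ w hw
          simp only [sub_apply, smul_apply, smul_eq_mul, coord_apply] at this ⊢
          linarith
        have hface := isFace_of_max _ _ hmax
        set Y := {w ∈ X | (u - μ • s • coord i) w = b} with hY
        have hYG : Y ∩ hyp i = G k := by
          rw [hGk, ← hXG]
          ext w
          simp only [hY, Set.mem_inter_iff, Set.mem_ofPred_eq, mem_hyp, sub_apply, smul_apply,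
            smul_eq_mul, coord_apply]
          constructor
          · rintro ⟨⟨h1, h2⟩, h3⟩
            rw [h3] at h2
            exact ⟨⟨h1, h3⟩, by linarith⟩
          · rintro ⟨⟨h1, h3⟩, h2⟩
            exact ⟨⟨h1, by rw [h3]; linarith⟩, h3⟩
        have hzY : z ∈ Y := ⟨hz, by
          simp only [sub_apply, smul_apply, smul_eq_mul, coord_apply] at hzμ ⊢
          linarith⟩
        have hlt := hface.dim_lt fun heq => by
          have h1 : G k = G (k + 1) := by rw [← hYG, ← hXG]; rw [heq]
          have h2 := hkG.2
          rw [h1, hkG'.2] at h2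
          push_cast at h2
          omega
        have hge := dim_add_one_le (A := G k) (B := Y) (by rw [← hYG]; exact Set.inter_subset_left)
          (s • coord i) 0 (fun w hw => by
            rw [← hYG] at hw
            simp [show w i = 0 from hw.2]) ⟨z, hzY, hzi.ne'⟩
        refine ⟨Y, ⟨hX.trans hP hface, ?_, ?_, z, hzY, hzi⟩, hface.subset⟩
        · rw [hkG.2] at hge
          rw [hdX] at hlt
          push_cast at hlt hge ⊢
          omega
        · simpa using hYG)
  refine ⟨fun k => if k ≤ n + 1 then F k else ∅, ⟨fun k hk => ?_, fun k hk => ?_, fun k hk => ?_⟩,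
    ?_, ?_⟩
  · simp only [hk, if_true]; exact ⟨(hF k hk).1, (hF k hk).2.1⟩
  · simp only [show k ≤ n + 1 by omega, show k + 1 ≤ n + 1 by omega, if_true]; exact hr k hk
  · simp [show ¬ k ≤ n + 1 by omega]
  · funext k
    by_cases hk : k ≤ n
    · have := (hF (k + 1) (by omega)).2.2.1
      simpa [sec, hk] using this
    · simp [sec, hk, hG.2.2 k (by omega)]
  · intro y hy
    simp only [Nat.zero_le, if_true] at hy
    obtain ⟨-, h2, -, x, hx, hxi⟩ := hF 0 (by omega)
    rwa [eq_of_dim_eq_zero (by simpa using h2) hy hx]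

/-- A lift of a wall-free chain is wall-free: a wall in a chain of faces of `P` induces a wall in the
chain of its sections. -/
theorem wallFree_of_sec {P : Set 𝔼} {i : Fin d} {n : ℕ}
    {F : ℕ → Set 𝔼} (hF : F ∈ fullChains P (n + 1)) (hG : sec i F ∈ wallFree (P ∩ hyp i) n)
    (h0 : ∀ x ∈ F 0, x i ≠ 0) : F ∈ wallFree P (n + 1) := by
  refine ⟨hF, ?_⟩
  rintro k hk ⟨j, hj, ⟨y, hy, hyj⟩, hdrop⟩
  -- The smaller face is the section of the larger one by `hyp j`.
  have hFk : F k = F (k + 1) ∩ hyp j := by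
    have hsub : F k ⊆ F (k + 1) ∩ hyp j := Set.subset_inter (hF.2.1 k hk) hj
    have h1 := dim_add_one_le (A := F (k + 1) ∩ hyp j) Set.inter_subset_left (coord j) 0
      (fun x hx => hx.2) ⟨y, hy, hyj⟩
    refine (hF.1 k hk.le).1.eq_of_dim_le hsub
      (Set.inter_subset_left.trans (hF.1 (k + 1) hk).1.subset) ?_
    rw [(hF.1 (k + 1) hk).2] at h1
    rw [(hF.1 k hk.le).2]
    push_cast at h1
    omega
  have hsec : ∀ x ∈ sec i F k, drop j x ∈ sec i F k := by
    rintro x ⟨hx, hxi⟩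
    refine ⟨hdrop x hx, ?_⟩
    rw [mem_hyp] at *
    rw [drop_apply, hxi, ite_self]
  -- The section of the larger face is not contained in `hyp j`, by comparison of dimensions.
  obtain ⟨w, hw, hwj⟩ : ∃ w ∈ sec i F k, w j ≠ 0 := by
    by_contra hcon
    push Not at hcon
    have hle : sec i F k ⊆ F k ∩ hyp i := fun x hx => ⟨by
      rw [hFk]; exact ⟨hx.1, hcon x hx⟩, hx.2⟩
    have hdk := (hG.1.1 k (by omega)).2
    have hne := fullChains_nonempty hG.1 (by omega : k ≤ n)
    rcases k with _ | k
    · obtain ⟨x, hx⟩ := hne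
      exact h0 x (hle hx).1 (hle hx).2
    · have h1 := dim_mono hle
      have h2 := (hG.1.1 k (by omega)).2
      rw [hdk, show F (k + 1) ∩ hyp i = sec i F k from rfl, h2] at h1
      push_cast at h1
      omega
  rcases k with _ | k
  · have h1 := eq_of_dim_eq_zero (by simpa using (hG.1.1 0 (by omega)).2) hw (hsec w hw)
    refine hwj ?_
    rw [h1, drop_apply_self]
  · exact hG.2 k (by omega) ⟨j, fun x hx => hj hx.1, ⟨w, hw, hwj⟩, hsec⟩

/-- The core of the disjointness of lifts. If the sections of `A` by two coordinate hyperplanes agree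
and the ratio `x j / v j` exceeds `x i / v i` on `B` off its facet `A`, then the section of `B` in
direction `j` is a wall over that of `A`. -/
theorem isWall_sec {P A B : Set 𝔼} {i j : Fin d} (hij : i ≠ j) (hdrop : ∀ x ∈ P, drop i x ∈ P)
    (hB : IsFace P B) (hAB : A ⊆ B) (hsec : A ∩ hyp i = A ∩ hyp j) {v : 𝔼}
    (hv : v ∈ A) (hvi : v i ≠ 0) (hpos : ∀ x ∈ B, x ∉ A → x i / v i < x j / v j)
    (hne : ¬ B ∩ hyp j ⊆ A) :
    A ∩ hyp j ⊆ hyp i ∧ (∃ x ∈ B ∩ hyp j, x i ≠ 0) ∧ ∀ x ∈ B ∩ hyp j, drop i x ∈ B ∩ hyp j := by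
  obtain ⟨z, ⟨hzB, hzj⟩, hzA⟩ := Set.not_subset.1 hne
  have hz := hpos z hzB hzA
  rw [show z j = 0 from hzj, zero_div] at hz
  have hBdrop : ∀ x ∈ B, drop i x ∈ B := by
    refine hB.drop_mem hdrop (Or.inr ?_)
    rcases lt_or_gt_of_ne hvi with h | h
    · have : 0 < z i := by
        by_contra hcon
        exact absurd hz (not_lt.2 (div_nonneg_of_nonpos (not_lt.1 hcon) h.le))
      exact ⟨z, hzB, v, hAB hv, this, h⟩
    · have : z i < 0 := by
        by_contra hcon
        exact absurd hz (not_lt.2 (div_nonneg (not_lt.1 hcon) h.le))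
      exact ⟨v, hAB hv, z, hzB, h, this⟩
  refine ⟨?_, ⟨z, ⟨hzB, hzj⟩, ?_⟩, ?_⟩
  · rw [← hsec]; exact Set.inter_subset_right
  · intro h
    rw [h, zero_div] at hz
    exact lt_irrefl _ hz
  · rintro x ⟨hx, hxj⟩
    exact ⟨hBdrop x hx, by rw [mem_hyp, drop_apply_of_ne hij.symm]; exact hxj⟩

/-- A chain cannot be a lift of wall-free chains in two different directions. -/
theorem lift_disjoint {P : Set 𝔼} {J : Finset (Fin d)} {i j : Fin d} (hij : i ≠ j) {n : ℕ}
    (hP : IsBlock P J) (hj : j ∈ J) (hdim : dim P = n + 1) {F : ℕ → Set 𝔼}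
    (hF : F ∈ fullChains P (n + 1))
    (hGi : sec i F ∈ wallFree (P ∩ hyp i) n) (hGj : sec j F ∈ wallFree (P ∩ hyp j) n)
    (h0i : ∀ x ∈ F 0, x i ≠ 0) (h0j : ∀ x ∈ F 0, x j ≠ 0) : False := by
  classical
  obtain ⟨v, hv⟩ := fullChains_nonempty hF (Nat.zero_le _)
  have hex : ∃ k, k ≤ n + 1 ∧ F k ∩ hyp i ≠ F k ∩ hyp j := by
    refine ⟨n + 1, le_rfl, fun h => ?_⟩
    rw [fullChains_top (by push_cast; exact hdim) hF] at h
    have h1 : EuclideanSpace.single j (1 : ℝ) ∈ P ∩ hyp i :=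
      ⟨hP.single_mem j hj 1 (Or.inl rfl), by simp [hij]⟩
    rw [h] at h1
    simpa using h1.2
  obtain ⟨hm, hmne⟩ := Nat.find_spec hex
  have hmin := fun k (hk : k < Nat.find hex) => Nat.find_min hex hk
  set m := Nat.find hex
  rcases m with _ | m
  · refine hmne ?_
    rw [Set.eq_empty_iff_forall_notMem.2 (fun x (hx : x ∈ F 0 ∩ hyp i) => h0i x hx.1 hx.2),
      Set.eq_empty_iff_forall_notMem.2 (fun x (hx : x ∈ F 0 ∩ hyp j) => h0j x hx.1 hx.2)]
  have hsec : F m ∩ hyp i = F m ∩ hyp j := by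
    by_contra h
    exact hmin m (by omega) ⟨by omega, h⟩
  have hvm : v ∈ F m := fullChains_subset hF (Nat.zero_le m) (by omega) hv
  have hvi := h0i v hv
  have hvj := h0j v hv
  have hfm := hF.1 m (by omega)
  have hfm' := hF.1 (m + 1) hm
  have hsub := hF.2.1 m (by omega)
  -- The functional comparing the two coordinates, scaled by their values at the vertex `v`.
  set q : StrongDual ℝ 𝔼 := (v j)⁻¹ • coord j - (v i)⁻¹ • coord i with hq
  have hqx : ∀ x, q x = x j / v j - x i / v i := fun x => by
    simp only [hq, sub_apply, smul_apply, smul_eq_mul, coord_apply]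
    ring
  have hqA : ∀ x ∈ F m, q x = 0 := by
    by_contra hcon
    push Not at hcon
    have hqv : q v = 0 := by rw [hqx, div_self hvi, div_self hvj, sub_self]
    -- Otherwise `F m ∩ hyp i`, its union with `{v}` and `F m` have three different dimensions.
    have h1 := dim_add_one_le (A := F m ∩ hyp i) (B := insert v (F m ∩ hyp i))
      (Set.subset_insert _ _) (coord i) 0 (fun x hx => hx.2) ⟨v, Set.mem_insert _ _, hvi⟩
    have h2 := dim_add_one_le (A := insert v (F m ∩ hyp i)) (B := F m)
      (Set.insert_subset hvm Set.inter_subset_left) q 0 (by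
        rintro x (rfl | hx)
        · exact hqv
        · rw [hqx, show x i = 0 from hx.2]
          rw [hsec] at hx
          rw [show x j = 0 from hx.2]; simp) hcon
    rw [hfm.2] at h2
    rcases m with _ | m
    · have := neg_one_le_dim (F 0 ∩ hyp i)
      push_cast at h2
      omega
    · have h3 := (hGi.1.1 m (by omega)).2
      rw [show F (m + 1) ∩ hyp i = sec i F m from rfl] at h1 h2
      push_cast at h2
      omega
  have hqB : ∃ x ∈ F (m + 1), q x ≠ 0 := by
    by_contra hcon
    push Not at hcon
    refine hmne ?_
    ext x
    refine and_congr_right fun hx => ?_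
    have := hcon x hx
    rw [hqx, sub_eq_zero, div_eq_div_iff hvj hvi] at this
    simp only [mem_hyp]
    constructor
    · intro h
      rw [h, zero_mul] at this
      exact (mul_eq_zero.1 this).resolve_right hvi
    · intro h
      rw [h, zero_mul] at this
      exact (mul_eq_zero.1 this.symm).resolve_right hvj
  -- The section of `F (m + 1)` has larger dimension than that of `F m`.
  have hnot : ∀ l, (l = i ∨ l = j) → sec l F ∈ wallFree (P ∩ hyp l) n →
      ¬ F (m + 1) ∩ hyp l ⊆ F m := by
    intro l hl hGl hle
    have hle' : sec l F m ⊆ F m ∩ hyp l := fun x hx => ⟨hle hx, hx.2⟩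
    have h1 := (hGl.1.1 m (by omega)).2
    rcases m with _ | m
    · obtain ⟨x, hx⟩ := fullChains_nonempty hGl.1 (Nat.zero_le n)
      rcases hl with rfl | rfl
      · exact h0i x (hle' hx).1 hx.2
      · exact h0j x (hle' hx).1 hx.2
    · have h2 := (hGl.1.1 m (by omega)).2
      have h3 := dim_mono hle'
      rw [h1, show F (m + 1) ∩ hyp l = sec l F m from rfl, h2] at h3
      push_cast at h3
      omega
  -- A wall between consecutive sections contradicts wall-freeness, or the dimension `0` of the
  -- first section.
  have hfin : ∀ l t, sec l F ∈ wallFree (P ∩ hyp l) n → F m ∩ hyp l ⊆ hyp t →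
      (∃ x ∈ F (m + 1) ∩ hyp l, x t ≠ 0) →
      (∀ x ∈ F (m + 1) ∩ hyp l, drop t x ∈ F (m + 1) ∩ hyp l) → False := by
    rintro l t hGl h1 ⟨x, hx, hxt⟩ h2
    rcases m with _ | m
    · have h3 := eq_of_dim_eq_zero (A := sec l F 0) (by simpa using (hGl.1.1 0 (by omega)).2)
        hx (h2 x hx)
      refine hxt ?_
      rw [h3, drop_apply_self]
    · exact hGl.2 m (by omega) ⟨t, h1, ⟨x, hx, hxt⟩, h2⟩
  rcases facet_sign hfm.1 ⟨v, hvm⟩ hsub hfm'.1.subset (by rw [hfm.2, hfm'.2]; push_cast; ring)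
    q 0 hqA hqB with h | h
  · obtain ⟨h1, h2, h3⟩ := isWall_sec hij (hP.drop_mem i) hfm'.1 hsub hsec hvm hvi
      (fun x hx hxA => by have := h x hx hxA; rw [hqx] at this; linarith)
      (hnot j (Or.inr rfl) hGj)
    exact hfin j i hGj h1 h2 h3
  · obtain ⟨h1, h2, h3⟩ := isWall_sec hij.symm (hP.drop_mem j) hfm'.1 hsub hsec.symm hvm hvj
      (fun x hx hxA => by have := h x hx hxA; rw [hqx] at this; linarith)
      (hnot i (Or.inl rfl) hGi)
    exact hfin i j hGi h1 h2 h3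

/-! ### Counting wall-free chains -/

/-- The wall-free chains whose sections by `hyp i` form a wall-free chain and whose vertex lies on the
side of `hyp i` given by the sign `s`. -/
def lifts (P : Set 𝔼) (n : ℕ) (p : Fin d × ℝ) : Set (ℕ → Set 𝔼) :=
  {F | F ∈ wallFree P (n + 1) ∧ sec p.1 F ∈ wallFree (P ∩ hyp p.1) n ∧ ∀ x ∈ F 0, 0 < p.2 * x p.1}

theorem IsBlock.dim_inter_hyp {P : Set 𝔼} {J : Finset (Fin d)} {n : ℕ} (hP : IsBlock P J)
    (hn : J.card = n + 1) {i : Fin d} (hi : i ∈ J) : dim (P ∩ hyp i) = n := by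
  rw [(hP.inter_hyp i).dim_eq, Finset.card_erase_of_mem hi, hn]; simp

theorem ncard_wallFree_le_lifts {P : Set 𝔼} {J : Finset (Fin d)} {n : ℕ} (hP : IsBlock P J)
    (hn : J.card = n + 1) {i : Fin d} (hi : i ∈ J) {s : ℝ} (hs : s = 1 ∨ s = -1) :
    (wallFree (P ∩ hyp i) n).ncard ≤ (lifts P n (i, s)).ncard := by
  have hfin : (lifts P n (i, s)).Finite :=
    (finite_wallFree hP.polytope (n + 1)).subset fun _ h => h.1
  refine le_trans (Set.ncard_le_ncard ?_ (hfin.image (sec i))) (Set.ncard_image_le hfin)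
  intro G hG
  obtain ⟨F, hF, rfl, h0⟩ := exists_lift hP hi (by rw [hP.dim_eq, hn]; simp)
    (hP.dim_inter_hyp hn hi) hs hG.1
  refine ⟨F, ⟨wallFree_of_sec hF hG fun x hx h => ?_, hG, h0⟩, rfl⟩
  have := h0 x hx
  rw [h, mul_zero] at this
  exact lt_irrefl _ this

theorem sum_lifts_le {P : Set 𝔼} {J : Finset (Fin d)} {n : ℕ} (hP : IsBlock P J)
    (hn : J.card = n + 1) :
    2 * ∑ i ∈ J, (wallFree (P ∩ hyp i) n).ncard ≤ (wallFree P (n + 1)).ncard ∧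
    ((wallFree P (n + 1)).ncard ≤ 2 * ∑ i ∈ J, (wallFree (P ∩ hyp i) n).ncard →
      ∀ F ∈ wallFree P (n + 1), ∃ i ∈ J, ∃ s, F ∈ lifts P n (i, s)) := by
  classical
  have hfin := finite_wallFree hP.polytope (n + 1)
  have hfin' : ∀ p, (lifts P n p).Finite := fun p => hfin.subset fun _ h => h.1
  set I : Finset (Fin d × ℝ) := J ×ˢ {1, -1} with hI
  have hdisj : (I : Set (Fin d × ℝ)).PairwiseDisjoint fun p => (hfin' p).toFinset := by
    rintro ⟨i, s⟩ hp ⟨j, t⟩ hq hne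
    simp only [hI, Finset.coe_product, Set.mem_prod, Finset.mem_coe, Finset.mem_insert,
      Finset.mem_singleton] at hp hq
    rw [Function.onFun, Finset.disjoint_left]
    intro F hF hF'
    rw [Set.Finite.mem_toFinset] at hF hF'
    obtain ⟨hF, hGi, h0i⟩ := hF
    obtain ⟨-, hGj, h0j⟩ := hF'
    simp only at hGi h0i hGj h0j
    by_cases hij : i = j
    · subst hij
      obtain ⟨v, hv⟩ := fullChains_nonempty hF.1 (Nat.zero_le _)
      have h1 := h0i v hv
      have h2 := h0j v hv
      rcases hp.2 with rfl | rfl <;> rcases hq.2 with rfl | rfl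
      · exact hne rfl
      · linarith
      · linarith
      · exact hne rfl
    · refine lift_disjoint hij hP hq.1 (by rw [hP.dim_eq, hn]; simp) hF.1 hGi hGj
        (fun x hx h => ?_) (fun x hx h => ?_)
      · have := h0i x hx
        rw [h, mul_zero] at this
        exact lt_irrefl _ this
      · have := h0j x hx
        rw [h, mul_zero] at this
        exact lt_irrefl _ this
  set U := I.biUnion fun p => (hfin' p).toFinset
  have hU : U ⊆ hfin.toFinset := by
    intro F hF
    obtain ⟨p, -, hp⟩ := Finset.mem_biUnion.1 hF
    rw [Set.Finite.mem_toFinset] at hp ⊢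
    exact hp.1
  have hcard : 2 * ∑ i ∈ J, (wallFree (P ∩ hyp i) n).ncard ≤ U.card := by
    rw [Finset.card_biUnion hdisj, hI, Finset.sum_product, Finset.mul_sum]
    refine Finset.sum_le_sum fun i hi => ?_
    rw [Finset.sum_pair (by norm_num)]
    simp only [← Set.ncard_eq_toFinset_card]
    have h1 := ncard_wallFree_le_lifts hP hn hi (Or.inl (rfl : (1 : ℝ) = 1))
    have h2 := ncard_wallFree_le_lifts hP hn hi (Or.inr (rfl : (-1 : ℝ) = -1))
    omega
  rw [Set.ncard_eq_toFinset_card _ hfin]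
  refine ⟨hcard.trans (Finset.card_le_card hU), fun hle F hF => ?_⟩
  have heq := Finset.eq_of_subset_of_card_le hU (hle.trans hcard)
  have hFU : F ∈ U := by rw [heq, Set.Finite.mem_toFinset]; exact hF
  obtain ⟨p, hp, hFp⟩ := Finset.mem_biUnion.1 hFU
  rw [Set.Finite.mem_toFinset] at hFp
  exact ⟨p.1, (Finset.mem_product.1 hp).1, p.2, hFp⟩

theorem le_ncard_wallFree {P : Set 𝔼} {J : Finset (Fin d)} {n : ℕ} (hP : IsBlock P J)
    (hn : J.card = n) : 2 ^ n * n ! ≤ (wallFree P n).ncard := by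
  induction n generalizing P J with
  | zero =>
    have hdim : dim P = 0 := by rw [hP.dim_eq, hn]; simp
    have : (wallFree P 0).Nonempty := by
      refine ⟨fun k => if k ≤ 0 then P else ∅, ⟨fun k hk => ?_, fun k hk => absurd hk (by omega),
        fun k hk => ?_⟩, fun k hk => absurd hk (by omega)⟩
      · obtain rfl : k = 0 := by omega
        simpa using ⟨isFace_self P, hdim⟩
      · simp [show k ≠ 0 by omega]
    simpa [Nat.one_le_iff_ne_zero, Nat.pos_iff_ne_zero] using
      (Set.ncard_pos (finite_wallFree hP.polytope 0)).2 this
  | succ n ih =>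
    refine le_trans ?_ (sum_lifts_le hP hn).1
    have h1 : ∑ _i ∈ J, 2 ^ n * n ! ≤ ∑ i ∈ J, (wallFree (P ∩ hyp i) n).ncard :=
      Finset.sum_le_sum fun i hi => ih (hP.inter_hyp i) (by
        rw [Finset.card_erase_of_mem hi, hn]; simp)
    rw [Finset.sum_const, hn, smul_eq_mul] at h1
    rw [Nat.factorial_succ, pow_succ]
    calc 2 ^ n * 2 * ((n + 1) * n !) = 2 * ((n + 1) * (2 ^ n * n !)) := by ring
      _ ≤ _ := Nat.mul_le_mul_left 2 h1

/-- If the minimum is attained, it is attained by all coordinate hyperplane sections, and every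
wall-free chain is a lift. -/
theorem ncard_wallFree_eq {P : Set 𝔼} {J : Finset (Fin d)} {n : ℕ} (hP : IsBlock P J)
    (hn : J.card = n + 1) (h : (wallFree P (n + 1)).ncard = 2 ^ (n + 1) * (n + 1)!) :
    (∀ i ∈ J, (wallFree (P ∩ hyp i) n).ncard = 2 ^ n * n !) ∧
    ∀ F ∈ wallFree P (n + 1), ∃ i ∈ J, ∃ s, F ∈ lifts P n (i, s) := by
  obtain ⟨h1, h2⟩ := sum_lifts_le hP hn
  have hle : ∀ i ∈ J, 2 ^ n * n ! ≤ (wallFree (P ∩ hyp i) n).ncard := fun i hi =>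
    le_ncard_wallFree (hP.inter_hyp i) (by rw [Finset.card_erase_of_mem hi, hn]; simp)
  have hsum : ∑ _i ∈ J, 2 ^ n * n ! = (n + 1) * (2 ^ n * n !) := by
    rw [Finset.sum_const, hn, smul_eq_mul]
  have htot : (wallFree P (n + 1)).ncard = 2 * ((n + 1) * (2 ^ n * n !)) := by
    rw [h, Nat.factorial_succ, pow_succ]; ring
  have hsle := Finset.sum_le_sum hle
  have heq : ∑ _i ∈ J, 2 ^ n * n ! = ∑ i ∈ J, (wallFree (P ∩ hyp i) n).ncard := by omega
  refine ⟨fun i hi => ((Finset.sum_eq_sum_iff_of_le hle).1 heq i hi).symm, h2 ?_⟩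
  omega

/-! ### Walls of coordinate sections -/

theorem dim_le_dim_add_one {A B : Set 𝔼} {i : Fin d} (hA : A.Nonempty) (h : ∀ x ∈ B, drop i x ∈ A) :
    dim B ≤ dim A + 1 := by
  obtain ⟨p, hp⟩ := hA
  rcases B.eq_empty_or_nonempty with rfl | hB
  · rw [dim_empty]; have := dim_nonneg ⟨p, hp⟩; omega
  rw [dim_of_nonempty ⟨p, hp⟩, dim_of_nonempty hB]
  set W : Submodule ℝ 𝔼 := vectorSpan ℝ A ⊔ Submodule.span ℝ {EuclideanSpace.single i (1 : ℝ)}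
  have hle : vectorSpan ℝ B ≤ W := by
    have hz : ∀ z ∈ B, z - p ∈ W := by
      intro z hz
      have h1 : drop i z - p ∈ W := Submodule.mem_sup_left (vsub_mem_vectorSpan ℝ (h z hz) hp)
      have h2 : z i • EuclideanSpace.single i (1 : ℝ) ∈ W := Submodule.mem_sup_right
        (Submodule.smul_mem _ _ (Submodule.mem_span_singleton_self _))
      have h3 := W.add_mem h1 h2
      rwa [show drop i z - p + z i • EuclideanSpace.single i (1 : ℝ) = z - p by
        unfold drop; abel] at h3
    refine Submodule.span_le.2 ?_
    rintro _ ⟨x, hx, y, hy, rfl⟩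
    have h1 := W.sub_mem (hz x hx) (hz y hy)
    rwa [sub_sub_sub_cancel_right] at h1
  have h1 := Submodule.finrank_mono hle
  have h2 : Module.finrank ℝ W ≤ _ := Submodule.finrank_add_le_finrank_add_finrank
    (vectorSpan ℝ A) (Submodule.span ℝ {EuclideanSpace.single i (1 : ℝ)})
  have h3 : Module.finrank ℝ (Submodule.span ℝ {EuclideanSpace.single i (1 : ℝ)} :
      Submodule ℝ 𝔼) ≤ 1 :=
    (finrank_span_le_card ({EuclideanSpace.single i (1 : ℝ)} : Set 𝔼)).trans (by simp)
  omega

theorem drop_eq_self {i : Fin d} {x : 𝔼} (h : x i = 0) : drop i x = x := by simp [drop, h]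

theorem drop_comm (i j : Fin d) (x : 𝔼) : drop i (drop j x) = drop j (drop i x) := by
  ext k
  simp only [drop_apply]
  split_ifs <;> rfl

/-- The preimage of a face of a coordinate section under the projection to that section is a face. -/
theorem IsFace.preimage_drop {P A : Set 𝔼} {j : Fin d} (hP : ∀ x ∈ P, drop j x ∈ P)
    (hA : IsFace (P ∩ hyp j) A) : IsFace P {x ∈ P | drop j x ∈ A} := by
  rcases A.eq_empty_or_nonempty with rfl | hne
  · simpa using isFace_empty P
  obtain ⟨l, M, hM, hA'⟩ := hA.exists_max hne
  have hl : ∀ x, (l - l (EuclideanSpace.single j 1) • coord j) x = l (drop j x) := fun x => by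
    rw [map_drop]
    simp only [sub_apply, smul_apply, smul_eq_mul, coord_apply]
    ring
  convert isFace_of_max (P := P) (l - l (EuclideanSpace.single j 1) • coord j) M (fun x hx => by
    rw [hl]; exact hM _ ⟨hP x hx, drop_apply_self j x⟩) using 1
  ext x
  simp only [Set.mem_ofPred_eq, hl, hA', Set.mem_inter_iff, mem_hyp, drop_apply_self, and_true]
  exact ⟨fun h => ⟨h.1, h.2.2⟩, fun h => ⟨h.1, hP x h.1, h.2⟩⟩

/-- A wall among the faces of a coordinate section gives, by taking preimages under the projection to
the section, a wall among the faces of `P`. -/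
theorem wallFree_inter_hyp {P : Set 𝔼} {J : Finset (Fin d)} {n : ℕ} (hP : IsBlock P J)
    (hn : J.card = n + 1) {j : Fin d} (hw : ∀ F ∈ fullChains P (n + 1), F ∈ wallFree P (n + 1)) :
    ∀ G ∈ fullChains (P ∩ hyp j) n, G ∈ wallFree (P ∩ hyp j) n := by
  rintro G hG
  refine ⟨hG, ?_⟩
  rintro k hk ⟨i, hAi, ⟨y, hy, hyi⟩, hdrop⟩
  have hA := hG.1 k hk.le
  have hB := hG.1 (k + 1) hk
  have hAB := hG.2.1 k hk
  have hij : i ≠ j := by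
    rintro rfl
    exact hyi (hB.1.subset hy).2
  have hAeq : ∀ x ∈ G (k + 1), x i = 0 → x ∈ G k := by
    have hsub : G k ⊆ G (k + 1) ∩ hyp i := Set.subset_inter hAB hAi
    have h1 := dim_add_one_le (A := G (k + 1) ∩ hyp i) Set.inter_subset_left (coord i) 0
      (fun x hx => hx.2) ⟨y, hy, hyi⟩
    have := hA.1.eq_of_dim_le hsub (Set.inter_subset_left.trans hB.1.subset) (by
      rw [hB.2] at h1
      rw [hA.2]
      push_cast at h1
      omega)
    intro x hx hxi
    rw [this]
    exact ⟨hx, hxi⟩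
  set A' := {x ∈ P | drop j x ∈ G k}
  set B' := {x ∈ P | drop j x ∈ G (k + 1)}
  have hA' : IsFace P A' := hA.1.preimage_drop (hP.drop_mem j)
  have hB' : IsFace P B' := hB.1.preimage_drop (hP.drop_mem j)
  have hAB' : A' ⊆ B' := fun x hx => ⟨hx.1, hAB hx.2⟩
  have hGA : ∀ m, ∀ x ∈ P ∩ hyp j, x ∈ G m → x ∈ {x ∈ P | drop j x ∈ G m} := fun m x hx hxm =>
    ⟨hx.1, by rw [drop_eq_self hx.2]; exact hxm⟩
  have hA'i : A' ⊆ hyp i := fun x hx => by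
    have := hAi hx.2
    rwa [mem_hyp, drop_apply_of_ne hij] at this
  have hyB' : y ∈ B' := hGA _ y (hB.1.subset hy) hy
  have hdrop' : ∀ x ∈ B', drop i x ∈ B' := fun x hx => ⟨hP.drop_mem i x hx.1, by
    rw [drop_comm]; exact hdrop _ hx.2⟩
  have hne : A'.Nonempty := by
    obtain ⟨p, hp⟩ := fullChains_nonempty hG hk.le
    exact ⟨p, hGA _ p (hA.1.subset hp) hp⟩
  have h1 : dim A' + 1 ≤ dim B' := dim_add_one_le hAB' (coord i) 0 hA'i ⟨y, hyB', hyi⟩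
  have h2 : dim B' ≤ dim A' + 1 := dim_le_dim_add_one hne (i := i) fun x hx =>
    ⟨hP.drop_mem i x hx.1, hAeq _ (hdrop' x hx).2 (by rw [drop_comm, drop_apply, drop_apply]; simp)⟩
  have h3 := dim_nonneg hne
  obtain ⟨a, ha⟩ := Int.eq_ofNat_of_zero_le h3
  obtain ⟨han, F, hF, hFA, hFB⟩ := exists_fullChain hP.polytope (n := n + 1) (a := a)
    (by rw [hP.dim_eq, hn]) hA' hB' hAB' ha (by omega)
  refine (hw F hF).2 a han ?_
  rw [hFA, hFB]
  exact ⟨i, hA'i, ⟨y, hyB', hyi⟩, hdrop'⟩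

/-- Coordinate sections all of whose full chains are wall-free and which have the least possible
number of them. -/
structure IsMinimal (P : Set 𝔼) (J : Finset (Fin d)) : Prop where
  block : IsBlock P J
  ncard_eq : (wallFree P J.card).ncard = (2 ^ J.card * J.card !)
  all_wallFree : ∀ F ∈ fullChains P J.card, F ∈ wallFree P J.card

theorem IsMinimal.ncard_fullChains {P : Set 𝔼} {J : Finset (Fin d)} (h : IsMinimal P J) :
    (fullChains P J.card).ncard = 2 ^ J.card * J.card ! := by
  rw [← h.ncard_eq]
  congr 1
  exact Set.Subset.antisymm h.all_wallFree fun _ hF => hF.1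

/-- If the number of all full chains equals the lower bound for the wall-free ones, there are no
others. -/
theorem isMinimal_of_ncard {P : Set 𝔼} {J : Finset (Fin d)} (hP : IsBlock P J)
    (h : (fullChains P J.card).ncard = 2 ^ J.card * J.card !) : IsMinimal P J := by
  have hsub : wallFree P J.card ⊆ fullChains P J.card := fun _ hF => hF.1
  have heq := Set.eq_of_subset_of_ncard_le hsub (by rw [h]; exact le_ncard_wallFree hP rfl)
    (finite_fullChains hP.polytope _)
  exact ⟨hP, by rw [heq, h], fun F hF => by rw [heq]; exact hF⟩

theorem IsMinimal.inter_hyp {P : Set 𝔼} {J : Finset (Fin d)} (h : IsMinimal P J) {i : Fin d}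
    (hi : i ∈ J) : IsMinimal (P ∩ hyp i) (J.erase i) := by
  obtain ⟨n, hn⟩ : ∃ n, J.card = n + 1 := ⟨J.card - 1, by
    have := Finset.card_pos.2 ⟨i, hi⟩; omega⟩
  have hn' : (J.erase i).card = n := by rw [Finset.card_erase_of_mem hi, hn]; simp
  have h1 := h.ncard_eq
  have h2 := h.all_wallFree
  rw [hn] at h1 h2
  refine ⟨h.block.inter_hyp i, ?_, ?_⟩
  · rw [hn']; exact (ncard_wallFree_eq h.block hn h1).1 i hi
  · rw [hn']; exact wallFree_inter_hyp h.block hn h2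

theorem IsMinimal.inter_coords {P : Set 𝔼} (h : IsMinimal P Finset.univ) (K : Finset (Fin d)) :
    IsMinimal {x ∈ P | ∀ i ∈ K, x i = 0} (Finset.univ \ K) := by
  classical
  induction K using Finset.induction_on with
  | empty => simpa using h
  | insert i K hi ih =>
    have := ih.inter_hyp (i := i) (by simp [hi])
    convert this using 1
    · ext x
      simp only [Finset.forall_mem_insert, Set.mem_ofPred_eq, Set.mem_inter_iff, mem_hyp]
      tauto
    · ext k
      simp only [Finset.mem_sdiff, Finset.mem_erase, Finset.mem_insert, Finset.mem_univ]
      tauto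

/-! ### Planar sections -/

theorem card_pair {i j : Fin d} (hij : i ≠ j) : ({i, j} : Finset (Fin d)).card = 2 :=
  Finset.card_pair hij

theorem map_single (l : StrongDual ℝ 𝔼) (k : Fin d) (r : ℝ) :
    l (EuclideanSpace.single k r) = r * l (EuclideanSpace.single k 1) := by
  have h : EuclideanSpace.single k r = r • EuclideanSpace.single k (1 : ℝ) := by
    ext m; simp [PiLp.single_apply]
  rw [h, map_smul, smul_eq_mul]

/-- The vertices of a coordinate segment are the unit vectors `± e o`. -/
theorem eq_single_of_isFace {Q A : Set 𝔼} {o : Fin d} (hQ : IsBlock Q {o}) (hA : IsFace Q A)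
    (hdim : dim A = 0) : ∃ r : ℝ, (r = 1 ∨ r = -1) ∧ EuclideanSpace.single o r ∈ A := by
  obtain ⟨p, hp⟩ := nonempty_of_dim_nonneg hdim.ge
  obtain ⟨l, M, hM, hA'⟩ := hA.exists_max ⟨p, hp⟩
  have hpQ := hA.subset hp
  have hpo : p = EuclideanSpace.single o (p o) := by
    ext k
    by_cases hk : k = o
    · subst hk; simp
    · simp [hk, hQ.support p hpQ k (by simpa using hk)]
  refine ⟨p o, ?_, hpo ▸ hp⟩
  have h1 := hQ.single_mem o (by simp) 1 (Or.inl rfl)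
  have h2 := hQ.single_mem o (by simp) (-1) (Or.inr rfl)
  have hl := map_single l o
  have hlp : l p = p o * l (EuclideanSpace.single o 1) := by
    conv_lhs => rw [hpo]
    exact hl _
  have hpM : l p = M := by rw [hA'] at hp; exact hp.2
  have h3 := hM _ h1
  have h4 := hM _ h2
  rw [hl] at h4
  have habs := abs_le.1 (hQ.abs_le p hpQ o)
  rcases lt_trichotomy (l (EuclideanSpace.single o 1)) 0 with h | h | h
  · right
    nlinarith
  · exfalso
    have e1 : EuclideanSpace.single o (1 : ℝ) ∈ A := by
      rw [hA']; exact ⟨h1, by rw [← hpM, hlp, h, mul_zero]⟩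
    have e2 : EuclideanSpace.single o (-1 : ℝ) ∈ A := by
      rw [hA']; exact ⟨h2, by rw [← hpM, hlp, hl, h, mul_zero, mul_zero]⟩
    have e3 := congrArg (fun x : 𝔼 => x o) (eq_of_dim_eq_zero hdim e1 e2)
    norm_num at e3
  · left
    nlinarith

/-- In a minimal planar section every incident pair of a vertex and an edge comes from a lift: the
edge contains one of the points `± e o`, where `o` is one of the two coordinates, and the other
coordinate of the vertex does not vanish. -/
theorem IsMinimal.exists_single_mem {P A E : Set 𝔼} {i j : Fin d} (hij : i ≠ j)
    (hP : IsMinimal P {i, j}) (hA : IsFace P A) (hE : IsFace P E) (hAE : A ⊆ E) (hdA : dim A = 0)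
    (hdE : dim E = 1) : ∃ k o : Fin d, (k = i ∧ o = j ∨ k = j ∧ o = i) ∧ (∀ x ∈ A, x k ≠ 0) ∧
      ∃ r : ℝ, (r = 1 ∨ r = -1) ∧ EuclideanSpace.single o r ∈ E := by
  have hn := card_pair hij
  obtain ⟨-, F, hF, rfl, rfl⟩ := exists_fullChain hP.block.polytope (n := 2) (a := 0)
    (by rw [hP.block.dim_eq, hn]) hA hE hAE (by simpa using hdA) (by simpa using hdE)
  have h1 := hP.ncard_eq
  have h2 := hP.all_wallFree
  rw [hn] at h1 h2
  obtain ⟨k, hk, s, hFl⟩ := (ncard_wallFree_eq hP.block hn h1).2 F (h2 F hF)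
  have hsec := hFl.2.1.1.1 0 (by omega)
  have h0 : ∀ x ∈ F 0, x k ≠ 0 := fun x hx h => by
    have h3 : 0 < s * x k := hFl.2.2 x hx
    rw [h, mul_zero] at h3
    exact lt_irrefl _ h3
  have hkey : ∀ o, ({i, j} : Finset (Fin d)).erase k = {o} →
      ∃ r : ℝ, (r = 1 ∨ r = -1) ∧ EuclideanSpace.single o r ∈ F (0 + 1) := by
    intro o ho
    have hQ := hP.block.inter_hyp k
    rw [ho] at hQ
    obtain ⟨r, hr, hmem⟩ := eq_single_of_isFace hQ hsec.1 (by simpa using hsec.2)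
    exact ⟨r, hr, hmem.1⟩
  rw [Finset.mem_insert, Finset.mem_singleton] at hk
  rcases hk with rfl | rfl
  · exact ⟨k, j, Or.inl ⟨rfl, rfl⟩, h0, hkey j (Finset.erase_insert (by simpa using hij))⟩
  · refine ⟨k, i, Or.inr ⟨rfl, rfl⟩, h0, hkey i ?_⟩
    rw [Finset.pair_comm]
    exact Finset.erase_insert (by simpa using hij.symm)

theorem mul_self_of_sign {s : ℝ} (hs : s = 1 ∨ s = -1) : s * s = 1 := by
  rcases hs with rfl | rfl <;> norm_num

theorem IsBlock.map_eq {P : Set 𝔼} {i j : Fin d} (hij : i ≠ j) (hP : IsBlock P {i, j})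
    (l : StrongDual ℝ 𝔼) {x : 𝔼} (hx : x ∈ P) :
    l x = x i * l (EuclideanSpace.single i 1) + x j * l (EuclideanSpace.single j 1) := by
  rw [map_eq_sum, ← Finset.sum_subset (Finset.subset_univ {i, j}) fun k _ hk => by
    rw [hP.support x hx k hk, zero_mul], Finset.sum_pair hij]

/-- An edge through `s e i` whose exposing functional takes a value strictly between `0` and its
maximum at `t e j` would form, with the vertex `s e i`, a chain that is not a lift. -/
theorem IsMinimal.slope_eq {P E : Set 𝔼} {i j : Fin d} (hij : i ≠ j) (hP : IsMinimal P {i, j})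
    {s t : ℝ} (hs : s = 1 ∨ s = -1) (ht : t = 1 ∨ t = -1) {l : StrongDual ℝ 𝔼} {M : ℝ}
    (hM : ∀ x ∈ P, l x ≤ M) (hE : E = {x ∈ P | l x = M}) (hdE : dim E = 1)
    (hi : s * l (EuclideanSpace.single i 1) = M) (hj0 : 0 ≤ t * l (EuclideanSpace.single j 1)) :
    t * l (EuclideanSpace.single j 1) = 0 ∨ t * l (EuclideanSpace.single j 1) = M := by
  by_contra hcon
  push Not at hcon
  have hl := map_single l
  have hB := hP.block
  have hjM : t * l (EuclideanSpace.single j 1) < M :=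
    lt_of_le_of_ne (by rw [← hl]; exact hM _ (hB.single_mem j (by simp) t ht)) hcon.2
  have hj0 := lt_of_le_of_ne hj0 hcon.1.symm
  have hss := mul_self_of_sign hs
  have htt := mul_self_of_sign ht
  have hei : EuclideanSpace.single i s ∈ P := hB.single_mem i (by simp) s hs
  have hle : ∀ x ∈ P, s * x i ≤ 1 := fun x hx => by
    have := abs_le.1 (hB.abs_le x hx i)
    rcases hs with rfl | rfl <;> linarith
  -- As `l` does not vanish at `e j`, `l = M` and `s * x i = 1` hold together on `P` only at `s e i`.
  have hface : IsFace P {EuclideanSpace.single i s} := by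
    convert isFace_of_max (P := P) (l + s • coord i) (M + 1) (fun x hx => by
      have h1 := hM x hx
      have h2 := hle x hx
      simp only [add_apply, smul_apply, smul_eq_mul, coord_apply]
      linarith) using 1
    ext x
    simp only [Set.mem_singleton_iff, Set.mem_ofPred_eq, add_apply, smul_apply, smul_eq_mul,
      coord_apply]
    constructor
    · rintro rfl
      exact ⟨hei, by rw [hl, hi]; simp [hss]⟩
    · rintro ⟨hx, h⟩
      have h1 := hM x hx
      have h2 := hle x hx
      have h3 : s * x i = 1 := by linarith
      have h4 : l x = M := by linarith
      have hxi : x i = s := by linear_combination s * h3 - x i * hss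
      rw [hB.map_eq hij l hx, hxi, hi] at h4
      have h5 : x j = 0 := by
        refine (mul_eq_zero.1 (show x j * l (EuclideanSpace.single j 1) = 0 by linarith)).resolve_right
          fun h => ?_
        rw [h, mul_zero] at hj0
        exact lt_irrefl _ hj0
      ext k
      by_cases hki : k = i
      · subst hki; simp [hxi]
      · by_cases hkj : k = j
        · subst hkj; simp [h5, hki]
        · simp [hki, hB.support x hx k (by simp [hki, hkj])]
  obtain ⟨k, o, hko, hk, r, hr, hmem⟩ := hP.exists_single_mem hij hface
    (by rw [hE]; exact isFace_of_max l M hM)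
    (by rw [hE, Set.singleton_subset_iff]; exact ⟨hei, by rw [hl, hi]⟩) (dim_singleton _) hdE
  have hk := hk _ rfl
  rcases hko with ⟨rfl, rfl⟩ | ⟨rfl, rfl⟩
  · rw [hE] at hmem
    have := hmem.2
    rw [hl] at this
    have hrt : r = t ∨ r = -t := by
      rcases hr with rfl | rfl <;> rcases ht with rfl | rfl <;> norm_num
    rcases hrt with rfl | rfl <;> linarith
  · simp [hij.symm] at hk

/-- The edges of a minimal planar section that meet the interior of a quadrant lie on one of three
lines. -/
theorem IsMinimal.edge_eq {P E : Set 𝔼} {i j : Fin d} (hij : i ≠ j) (hP : IsMinimal P {i, j})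
    {s t : ℝ} (hs : s = 1 ∨ s = -1) (ht : t = 1 ∨ t = -1) (hE : IsFace P E) (hdE : dim E = 1)
    {x : 𝔼} (hx : x ∈ E) (hxi : 0 < s * x i) (hxj : 0 < t * x j) :
    E = {y ∈ P | s * y i = 1} ∨ E = {y ∈ P | t * y j = 1} ∨
      (E = {y ∈ P | s * y i + t * y j = 1} ∧ ∀ y ∈ P, s * y i + t * y j ≤ 1) := by
  obtain ⟨l, M, hM, hE'⟩ := hE.exists_max ⟨x, hx⟩
  have hB := hP.block
  have hss := mul_self_of_sign hs
  have htt := mul_self_of_sign ht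
  have hxP := hE.subset hx
  have hlx : l x = M := by rw [hE'] at hx; exact hx.2
  set α := s * l (EuclideanSpace.single i 1) with hα
  set β := t * l (EuclideanSpace.single j 1) with hβ
  have hly : ∀ y ∈ P, l y = s * y i * α + t * y j * β := fun y hy => by
    rw [hB.map_eq hij l hy, hα, hβ]
    linear_combination -(y i * l (EuclideanSpace.single i 1)) * hss -
      (y j * l (EuclideanSpace.single j 1)) * htt
  have hα0 : 0 ≤ α := by
    have h1 := hM _ (hB.drop_mem i x hxP)
    rw [map_drop, hlx] at h1
    have h2 : 0 ≤ (s * x i) * α := by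
      rw [hα]; linear_combination h1 - (x i * l (EuclideanSpace.single i 1)) * hss
    exact nonneg_of_mul_nonneg_right h2 hxi
  have hβ0 : 0 ≤ β := by
    have h1 := hM _ (hB.drop_mem j x hxP)
    rw [map_drop, hlx] at h1
    have h2 : 0 ≤ (t * x j) * β := by
      rw [hβ]; linear_combination h1 - (x j * l (EuclideanSpace.single j 1)) * htt
    exact nonneg_of_mul_nonneg_right h2 hxj
  have hMpos : 0 < M := by
    have h1 := hM 0 hB.zero_mem
    rw [map_zero] at h1
    refine lt_of_le_of_ne h1 fun h => ?_
    have h2 := hly x hxP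
    rw [hlx, ← h] at h2
    have h3 := mul_nonneg hxi.le hα0
    have h4 := mul_nonneg hxj.le hβ0
    have h5 : α = 0 := (mul_eq_zero.1 (show s * x i * α = 0 by linarith)).resolve_left hxi.ne'
    have h6 : β = 0 := (mul_eq_zero.1 (show t * x j * β = 0 by linarith)).resolve_left hxj.ne'
    have h7 : E = P := by
      rw [hE']
      refine Set.Subset.antisymm (fun y hy => hy.1) fun y hy => ⟨hy, ?_⟩
      rw [hly y hy, h5, h6, ← h]; ring
    rw [h7, hB.dim_eq, card_pair hij] at hdE
    norm_num at hdE
  have hl := map_single l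
  have hlines : (α = M → β = 0 ∨ β = M) ∧ (β = M → α = 0 ∨ α = M) ∧ (α = M ∨ β = M) := by
    refine ⟨fun h => hP.slope_eq hij hs ht hM hE' hdE h hβ0, fun h => ?_, ?_⟩
    · rw [Finset.pair_comm] at hP
      exact hP.slope_eq hij.symm ht hs hM hE' hdE h hα0
    · have hEpoly := hE.isPolytope hB.polytope ⟨x, hx⟩
      obtain ⟨A, hA, -, hdA⟩ := exists_facet hEpoly (isFace_empty E) (by
        rw [dim_empty, hdE]; norm_num)
      obtain ⟨k, o, hko, -, r, hr, hmem⟩ := hP.exists_single_mem hij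
        (hE.trans hB.polytope hA) hE hA.subset (by omega) hdE
      rw [hE'] at hmem
      have h1 := hmem.2
      rw [hl] at h1
      rcases hko with ⟨-, rfl⟩ | ⟨-, rfl⟩
      · right
        have hrt : r = t ∨ r = -t := by
          rcases hr with rfl | rfl <;> rcases ht with rfl | rfl <;> norm_num
        rcases hrt with rfl | rfl
        · exact h1
        · linarith
      · left
        have hrs : r = s ∨ r = -s := by
          rcases hr with rfl | rfl <;> rcases hs with rfl | rfl <;> norm_num
        rcases hrs with rfl | rfl
        · exact h1
        · linarith
  obtain ⟨h1, h2, h3⟩ := hlines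
  have hcase : (α = M ∧ β = 0) ∨ (α = 0 ∧ β = M) ∨ (α = M ∧ β = M) := by
    rcases h3 with h | h
    · rcases h1 h with h' | h'
      · exact Or.inl ⟨h, h'⟩
      · exact Or.inr (Or.inr ⟨h, h'⟩)
    · rcases h2 h with h' | h'
      · exact Or.inr (Or.inl ⟨h', h⟩)
      · exact Or.inr (Or.inr ⟨h', h⟩)
  rcases hcase with ⟨ha, hb⟩ | ⟨ha, hb⟩ | ⟨ha, hb⟩
  · left
    rw [hE']
    ext y
    refine and_congr_right fun hy => ?_
    rw [hly y hy, ha, hb, mul_zero, add_zero]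
    exact mul_eq_right₀ hMpos.ne'
  · right; left
    rw [hE']
    ext y
    refine and_congr_right fun hy => ?_
    rw [hly y hy, ha, hb, mul_zero, zero_add]
    exact mul_eq_right₀ hMpos.ne'
  · right; right
    refine ⟨?_, fun y hy => ?_⟩
    · rw [hE']
      ext y
      refine and_congr_right fun hy => ?_
      rw [hly y hy, ha, hb, ← add_mul]
      exact mul_eq_right₀ hMpos.ne'
    · have h4 := hM y hy
      rw [hly y hy, ha, hb, ← add_mul] at h4
      exact (mul_le_iff_le_one_left hMpos).1 h4

/-- The far end of the side `s * x i = 1` in the direction `t e j`. -/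
theorem IsBlock.exists_eq_max {P : Set 𝔼} {i j : Fin d} (hij : i ≠ j) (hP : IsBlock P {i, j})
    {s t : ℝ} (hs : s = 1 ∨ s = -1) (ht : t = 1 ∨ t = -1) :
    ∃ a : ℝ, 0 ≤ a ∧ a ≤ 1 ∧ EuclideanSpace.single i s + EuclideanSpace.single j (t * a) ∈ P ∧
      ∀ y ∈ P, s * y i = 1 → t * y j ≤ a := by
  have hss := mul_self_of_sign hs
  have htt := mul_self_of_sign ht
  have hei : EuclideanSpace.single i s ∈ {x ∈ P | (s • coord i : StrongDual ℝ 𝔼) x = 1} :=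
    ⟨hP.single_mem i (by simp) s hs, by simp [hss]⟩
  obtain ⟨z, hz, hmax⟩ := (hP.polytope.inter_eq (s • coord i) 1).1.exists_isMaxOn ⟨_, hei⟩
    (t • coord j).continuous.continuousOn
  have hzi : s * z i = 1 := hz.2
  refine ⟨t * z j, ?_, ?_, ?_, fun y hy hyi => hmax ⟨hy, hyi⟩⟩
  · have := hmax hei
    simpa [hij.symm] using this
  · have := _root_.abs_le.1 (hP.abs_le z hz.1 j)
    rcases ht with rfl | rfl <;> linarith
  · convert hz.1 using 1
    rw [← mul_assoc, htt, one_mul]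
    have hzi : z i = s := by linear_combination s * hzi - z i * hss
    ext k
    by_cases hki : k = i
    · subst hki; simp [hzi, hij]
    · by_cases hkj : k = j
      · subst hkj; simp [hki]
      · simp [hki, hkj, hP.support z hz.1 k (by simp [hki, hkj])]

/-- Each quadrant of a minimal planar section is a square or a triangle. -/
theorem IsMinimal.quadrant {P : Set 𝔼} {i j : Fin d} (hij : i ≠ j) (hP : IsMinimal P {i, j})
    {s t : ℝ} (hs : s = 1 ∨ s = -1) (ht : t = 1 ∨ t = -1) :
    EuclideanSpace.single i s + EuclideanSpace.single j t ∈ P ∨ ∀ y ∈ P, s * y i + t * y j ≤ 1 := by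
  have hB := hP.block
  have hss := mul_self_of_sign hs
  have htt := mul_self_of_sign ht
  obtain ⟨a, ha0, ha1, hva, hamax⟩ := hB.exists_eq_max hij hs ht
  obtain ⟨b, hb0, hb1, hwb, hbmax⟩ := IsBlock.exists_eq_max hij.symm
    (by rw [Finset.pair_comm]; exact hB) ht hs
  rcases ha1.eq_or_lt with rfl | ha1
  · left; rwa [mul_one] at hva
  rcases hb1.eq_or_lt with rfl | hb1
  · left; rwa [mul_one, add_comm] at hwb
  right
  set v := EuclideanSpace.single i s + EuclideanSpace.single j (t * a)
  set w := EuclideanSpace.single j t + EuclideanSpace.single i (s * b)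
  have hvi : s * v i = 1 := by simp [v, hij, hss]
  have hvj : t * v j = a := by simp [v, hij.symm, ← mul_assoc, htt]
  have hwi : s * w i = b := by simp [w, hij, ← mul_assoc, hss]
  have hwj : t * w j = 1 := by simp [w, hij.symm, htt]
  -- This functional takes the same value at `v` and `w`, the far ends of the two sides of the
  -- bounding square.
  set l : StrongDual ℝ 𝔼 := (1 - a) • s • coord i + (1 - b) • t • coord j with hl
  have hly : ∀ y, l y = (1 - a) * (s * y i) + (1 - b) * (t * y j) := fun y => by
    simp [hl]
  obtain ⟨z, hz, hmax⟩ := hB.polytope.1.exists_isMaxOn ⟨v, hva⟩ l.continuous.continuousOn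
  have hab : a * b < 1 := by nlinarith
  have hlv : l v = 1 - a * b := by rw [hly, hvi, hvj]; ring
  have hlw : l w = 1 - a * b := by rw [hly, hwi, hwj]; ring
  have hzM : 1 - a * b ≤ l z := by rw [← hlv]; exact hmax hva
  have hB'' := isFace_of_max l (l z) hmax
  set B := {y ∈ P | l y = l z}
  have hle : ∀ y ∈ P, s * y i ≤ 1 ∧ t * y j ≤ 1 := fun y hy => by
    have h1 := abs_le.1 (hB.abs_le y hy i)
    have h2 := abs_le.1 (hB.abs_le y hy j)
    constructor
    · rcases hs with rfl | rfl <;> linarith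
    · rcases ht with rfl | rfl <;> linarith
  -- If `v` and `w` are maximizers, their midpoint is a maximizer inside the quadrant.
  have hx : ∃ x ∈ B, 0 < s * x i ∧ 0 < t * x j := by
    rcases hzM.eq_or_lt with h | h
    · refine ⟨(1 / 2 : ℝ) • v + (1 / 2 : ℝ) • w, ⟨hB.polytope.convex hva hwb (by norm_num)
        (by norm_num) (by norm_num), ?_⟩, ?_, ?_⟩
      · simp only [map_add, map_smul, smul_eq_mul, hlv, hlw, ← h]; ring
      · simp only [PiLp.add_apply, PiLp.smul_apply, smul_eq_mul]; linarith
      · simp only [PiLp.add_apply, PiLp.smul_apply, smul_eq_mul]; linarith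
    · obtain ⟨h1, h2⟩ := hle z hz
      rw [hly] at h
      refine ⟨z, ⟨hz, rfl⟩, ?_, ?_⟩
      · by_contra hcon
        nlinarith
      · by_contra hcon
        nlinarith
  obtain ⟨x, hxB, hxi, hxj⟩ := hx
  have hBP : B ≠ P := fun h => by
    have h0 := hB.zero_mem
    rw [← h] at h0
    have h1 := h0.2
    rw [map_zero] at h1
    linarith
  have hdP : dim P = 2 := by rw [hB.dim_eq, card_pair hij]; rfl
  obtain ⟨E, hE, hBE, hdE⟩ := exists_facet hB.polytope hB'' (by
    have := hB''.dim_lt hBP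
    omega)
  have hzB : z ∈ B := ⟨hz, rfl⟩
  rcases hP.edge_eq hij hs ht hE (by omega) (hBE hxB) hxi hxj with h | h | h
  · exfalso
    have hzi : s * z i = 1 := by have := hBE hzB; rw [h] at this; exact this.2
    have hzj := hamax z hz hzi
    have hzl := hly z
    rw [hzi] at hzl
    have hwB : w ∈ B := ⟨hwb, by rw [hlw]; nlinarith⟩
    have hwE := hBE hwB
    rw [h] at hwE
    have := hwE.2
    linarith
  · exfalso
    have hzj : t * z j = 1 := by have := hBE hzB; rw [h] at this; exact this.2
    have hzi := hbmax z hz hzj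
    have hzl := hly z
    rw [hzj] at hzl
    have hvB : v ∈ B := ⟨hva, by rw [hlv]; nlinarith⟩
    have hvE := hBE hvB
    rw [h] at hvE
    have := hvE.2
    linarith
  · exact h.2

/-- A square quadrant next to a triangular one would produce a wall. -/
theorem IsMinimal.corner_neg {P : Set 𝔼} {i j : Fin d} (hij : i ≠ j) (hP : IsMinimal P {i, j})
    {s t : ℝ} (hs : s = 1 ∨ s = -1) (ht : t = 1 ∨ t = -1)
    (h : EuclideanSpace.single i s + EuclideanSpace.single j t ∈ P) :
    EuclideanSpace.single i (-s) + EuclideanSpace.single j t ∈ P := by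
  have hB := hP.block
  have hss := mul_self_of_sign hs
  have htt := mul_self_of_sign ht
  have hs' : -s = 1 ∨ -s = -1 := by rcases hs with rfl | rfl <;> norm_num
  refine (hP.quadrant hij hs' ht).resolve_right fun hD => ?_
  have hej : EuclideanSpace.single j t ∈ P := hB.single_mem j (by simp) t ht
  have hle : ∀ y ∈ P, t * y j ≤ 1 := fun y hy => by
    have h2 := abs_le.1 (hB.abs_le y hy j)
    rcases ht with rfl | rfl <;> linarith
  have hface : IsFace P {EuclideanSpace.single j t} := by
    convert isFace_of_max (P := P) ((-s) • coord i + (2 * t) • coord j) 2 (fun x hx => by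
      have h1 := hD x hx
      have h2 := hle x hx
      simp only [add_apply, smul_apply, smul_eq_mul, coord_apply]
      linarith) using 1
    ext x
    simp only [Set.mem_singleton_iff, Set.mem_ofPred_eq, add_apply, smul_apply, smul_eq_mul,
      coord_apply]
    constructor
    · rintro rfl
      exact ⟨hej, by simp [hij]; linarith⟩
    · rintro ⟨hx, h⟩
      have h1 := hD x hx
      have h2 := hle x hx
      have h3 : t * x j = 1 := by linarith
      have h4 : s * x i = 0 := by linarith
      have hxj : x j = t := by linear_combination t * h3 - x j * htt
      have hxi : x i = 0 := by linear_combination s * h4 - x i * hss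
      ext k
      by_cases hkj : k = j
      · subst hkj; simp [hxj]
      · by_cases hki : k = i
        · subst hki; simp [hxi, hkj]
        · simp [hkj, hB.support x hx k (by simp [hki, hkj])]
  have hE : IsFace P {y ∈ P | (t • coord j : StrongDual ℝ 𝔼) y = 1} :=
    isFace_of_max (t • coord j) 1 hle
  set E := {y ∈ P | (t • coord j : StrongDual ℝ 𝔼) y = 1}
  have hcE : EuclideanSpace.single i s + EuclideanSpace.single j t ∈ E := ⟨h, by
    simp [hij.symm, htt]⟩
  have hci : (EuclideanSpace.single i s + EuclideanSpace.single j t : 𝔼) i ≠ 0 := by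
    rcases hs with rfl | rfl <;> simp [hij]
  have hsub : ({EuclideanSpace.single j t} : Set 𝔼) ⊆ E := by
    rw [Set.singleton_subset_iff]; exact ⟨hej, by simp [htt]⟩
  have hji : ∀ x ∈ ({EuclideanSpace.single j t} : Set 𝔼), x i = 0 := by
    rintro x rfl; simp [hij]
  have hdE : dim E = 0 + 1 := by
    have h1 := dim_add_one_le hsub (coord i) 0 hji ⟨_, hcE, hci⟩
    have h2 := hE.dim_lt fun heq => by
      have h0 := hB.zero_mem
      rw [← heq] at h0
      have := h0.2
      rw [map_zero] at this
      norm_num at this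
    rw [dim_singleton] at h1
    rw [hB.dim_eq, card_pair hij] at h2
    push_cast at h2
    omega
  obtain ⟨-, F, hF, hF0, hF1⟩ := exists_fullChain hB.polytope (n := 2) (a := 0)
    (by rw [hB.dim_eq, card_pair hij]) hface hE hsub (by rw [dim_singleton]; rfl) hdE
  have hw := hP.all_wallFree
  rw [card_pair hij] at hw
  refine (hw F hF).2 0 (by omega) ?_
  rw [hF0, hF1]
  refine ⟨i, hji, ⟨_, hcE, hci⟩, fun x hx => ⟨hB.drop_mem i x hx.1, ?_⟩⟩
  have h1 : t * x j = 1 := hx.2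
  simpa [drop_apply_of_ne hij.symm] using h1

theorem IsMinimal.square_or_diamond {P : Set 𝔼} {i j : Fin d} (hij : i ≠ j)
    (hP : IsMinimal P {i, j}) :
    (∀ x : 𝔼, (∀ k, k ≠ i → k ≠ j → x k = 0) → (x ∈ P ↔ |x i| ≤ 1 ∧ |x j| ≤ 1)) ∨
    (∀ x : 𝔼, (∀ k, k ≠ i → k ≠ j → x k = 0) → (x ∈ P ↔ |x i| + |x j| ≤ 1)) := by
  have hB := hP.block
  have hP' := hP
  rw [Finset.pair_comm] at hP'
  have hconv := hB.polytope.convex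
  have hi : ∀ {s t : ℝ}, (s = 1 ∨ s = -1) → (t = 1 ∨ t = -1) →
      EuclideanSpace.single i s + EuclideanSpace.single j t ∈ P →
      EuclideanSpace.single i (-s) + EuclideanSpace.single j t ∈ P := fun hs ht h =>
    hP.corner_neg hij hs ht h
  have hj : ∀ {s t : ℝ}, (s = 1 ∨ s = -1) → (t = 1 ∨ t = -1) →
      EuclideanSpace.single i s + EuclideanSpace.single j t ∈ P →
      EuclideanSpace.single i s + EuclideanSpace.single j (-t) ∈ P := fun hs ht h => by
    rw [add_comm] at h ⊢
    exact hP'.corner_neg hij.symm ht hs h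
  have hxeq : ∀ x : 𝔼, (∀ k, k ≠ i → k ≠ j → x k = 0) →
      x = EuclideanSpace.single i (x i) + EuclideanSpace.single j (x j) := by
    intro x hx
    ext k
    by_cases hki : k = i
    · subst hki; simp [hij]
    · by_cases hkj : k = j
      · subst hkj; simp [hki]
      · simp [hki, hkj, hx k hki hkj]
  have h1 : (1 : ℝ) = 1 ∨ (1 : ℝ) = -1 := Or.inl rfl
  have h2 : (-1 : ℝ) = 1 ∨ (-1 : ℝ) = -1 := Or.inr rfl
  by_cases hc : EuclideanSpace.single i (1 : ℝ) + EuclideanSpace.single j (1 : ℝ) ∈ P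
  · left
    have hc2 := hi h1 h1 hc
    have hc3 := hj h1 h1 hc
    have hc4 := hi h1 h2 hc3
    refine fun x hx => ⟨fun h => ⟨hB.abs_le x h i, hB.abs_le x h j⟩, fun ⟨hxi, hxj⟩ => ?_⟩
    rw [abs_le] at hxi hxj
    have hrow : ∀ t : ℝ, EuclideanSpace.single i (1 : ℝ) + EuclideanSpace.single j t ∈ P →
        EuclideanSpace.single i (-1 : ℝ) + EuclideanSpace.single j t ∈ P →
        EuclideanSpace.single i (x i) + EuclideanSpace.single j t ∈ P := by
      intro t ht ht'
      convert hconv ht ht' (a := (1 + x i) / 2) (b := (1 - x i) / 2) (by linarith) (by linarith)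
        (by ring) using 1
      ext k
      simp only [PiLp.add_apply, PiLp.smul_apply, smul_eq_mul, PiLp.single_apply]
      split_ifs <;> ring
    rw [hxeq x hx]
    convert hconv (hrow 1 hc hc2) (hrow (-1) hc3 hc4) (a := (1 + x j) / 2) (b := (1 - x j) / 2)
      (by linarith) (by linarith) (by ring) using 1
    ext k
    simp only [PiLp.add_apply, PiLp.smul_apply, smul_eq_mul, PiLp.single_apply]
    split_ifs <;> ring
  · right
    have hno : ∀ {s t : ℝ}, (s = 1 ∨ s = -1) → (t = 1 ∨ t = -1) →
        ∀ y ∈ P, s * y i + t * y j ≤ 1 := by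
      intro s t hs ht
      refine (hP.quadrant hij hs ht).resolve_left fun h => hc ?_
      have h' : EuclideanSpace.single i (1 : ℝ) + EuclideanSpace.single j t ∈ P := by
        rcases hs with rfl | rfl
        · exact h
        · simpa using hi h2 ht h
      rcases ht with rfl | rfl
      · exact h'
      · simpa using hj h1 h2 h'
    have hsign : ∀ r : ℝ, ∃ s : ℝ, (s = 1 ∨ s = -1) ∧ s * r = |r| := by
      intro r
      rcases abs_choice r with h | h
      · exact ⟨1, h1, by rw [h, one_mul]⟩
      · exact ⟨-1, h2, by rw [h]; ring⟩
    intro x hx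
    obtain ⟨s, hs, hsx⟩ := hsign (x i)
    obtain ⟨t, ht, htx⟩ := hsign (x j)
    rw [← hsx, ← htx]
    refine ⟨fun h => hno hs ht x h, fun h => ?_⟩
    have hsi : 0 ≤ s * x i := by rw [hsx]; exact abs_nonneg _
    have htj : 0 ≤ t * x j := by rw [htx]; exact abs_nonneg _
    have hmem := hconv.sum_mem (t := (Finset.univ : Finset (Fin 3)))
      (w := ![s * x i, t * x j, 1 - (s * x i + t * x j)])
      (z := ![EuclideanSpace.single i s, EuclideanSpace.single j t, 0])
      (by intro k _; fin_cases k <;> simp <;> linarith)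
      (by simp [Fin.sum_univ_three])
      (by
        intro k _
        fin_cases k
        · exact hB.single_mem i (by simp) s hs
        · exact hB.single_mem j (by simp) t ht
        · exact hB.zero_mem)
    convert hmem using 1
    have hss := mul_self_of_sign hs
    have htt := mul_self_of_sign ht
    ext k
    by_cases hki : k = i
    · subst hki
      simp [Fin.sum_univ_three, hij]
      linear_combination -(x k) * hss
    · by_cases hkj : k = j
      · subst hkj
        simp [Fin.sum_univ_three, hki]
        linear_combination -(x k) * htt
      · simp [Fin.sum_univ_three, hki, hkj, hx k hki hkj]

/-! ### Flags, coordinate subspaces and the given polytope -/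

/-- A flag is a full chain preceded by the empty face. -/
theorem ncard_flags {P : Set 𝔼} {n : ℕ} (hdim : dim P = n) :
    (flags P).ncard = (fullChains P n).ncard := by
  have hmem : ∀ k : ℕ, k ≤ n → (k : ℤ) ∈ Set.Icc (-1 : ℤ) (dim P) := fun k hk => by
    rw [hdim]; constructor <;> omega
  refine Set.ncard_congr
    (fun F _ k => if hk : k ≤ n then F ⟨k, hmem k hk⟩ else ∅) ?_ ?_ ?_
  · rintro F ⟨h1, h2⟩
    refine ⟨fun k hk => ?_, fun k hk => ?_, fun k hk => ?_⟩
    · simp only [hk, dif_pos]; exact h1 _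
    · simp only [hk.le, show k + 1 ≤ n from hk, dif_pos]
      exact (h2 _ _ (by rw [Subtype.mk_lt_mk]; push_cast; omega)).subset
    · simp [show ¬ k ≤ n by omega]
  · rintro F F' ⟨hF, -⟩ ⟨hF', -⟩ h
    funext ⟨m, hm⟩
    rcases m with k | k
    · have hk : k ≤ n := by have := hm.2; rw [hdim] at this; simpa using this
      have := congrFun h k
      simp only [hk, dif_pos] at this
      exact this
    · have hk : k = 0 := by have := hm.1; omega
      subst hk
      have hempty : ∀ {A : Set 𝔼}, dim A = -1 → A = ∅ := fun {A} hA => by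
        by_contra hne
        have := dim_nonneg (Set.nonempty_iff_ne_empty.2 hne)
        omega
      rw [hempty (hF ⟨Int.negSucc 0, hm⟩).2, hempty (hF' ⟨Int.negSucc 0, hm⟩).2]
  · intro G hG
    have hto : ∀ i : Set.Icc (-1 : ℤ) (dim P), i.1.toNat ≤ n := fun i => by
      have := i.2.2.trans hdim.le; omega
    refine ⟨fun i => if 0 ≤ i.1 then G i.1.toNat else ∅, ⟨fun i => ?_, fun i j hij => ?_⟩, ?_⟩
    · have hi := i.2.1
      by_cases h : 0 ≤ i.1
      · simp only [h, if_true]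
        have := hG.1 _ (hto i)
        exact ⟨this.1, by rw [this.2]; omega⟩
      · simp only [h, if_false]
        exact ⟨isFace_empty P, by rw [dim_empty]; omega⟩
    · have hij : i.1 < j.1 := hij
      have hi := i.2.1
      have hj : 0 ≤ j.1 := by omega
      simp only [hj, if_true]
      have hGj := hG.1 _ (hto j)
      by_cases h : 0 ≤ i.1
      · simp only [h, if_true]
        refine (fullChains_subset hG (by omega) (hto j)).ssubset_of_ne fun heq => ?_
        have h1 := (hG.1 _ (hto i)).2
        rw [heq, hGj.2] at h1
        omega
      · simp only [h, if_false]
        exact (Set.empty_ssubset).2 (fullChains_nonempty hG (hto j))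
    · funext k
      by_cases hk : k ≤ n
      · simp [hk]
      · simp [hk, hG.2.2 k (by omega)]

theorem mem_span_single {J : Set (Fin d)} {x : 𝔼} :
    x ∈ Submodule.span ℝ ((fun j : Fin d => EuclideanSpace.single j (1 : ℝ)) '' J) ↔
      ∀ k ∉ J, x k = 0 := by
  constructor
  · intro hx k hk
    have hle : Submodule.span ℝ ((fun j : Fin d => EuclideanSpace.single j (1 : ℝ)) '' J) ≤
        LinearMap.ker (coord k).toLinearMap := by
      refine Submodule.span_le.2 ?_
      rintro _ ⟨j, hj, rfl⟩
      have : k ≠ j := by rintro rfl; exact hk hj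
      simp [coord, this]
    exact hle hx
  · intro hx
    have : x = ∑ j, x j • EuclideanSpace.single j (1 : ℝ) := by
      conv_lhs => rw [← (EuclideanSpace.basisFun (Fin d) ℝ).sum_repr x]
      simp
    rw [this]
    refine Submodule.sum_mem _ fun j _ => ?_
    by_cases hj : j ∈ J
    · exact Submodule.smul_mem _ _ (Submodule.subset_span ⟨j, hj, rfl⟩)
    · rw [hx j hj, zero_smul]; exact Submodule.zero_mem _

theorem finrank_span_single (J : Finset (Fin d)) :
    Module.finrank ℝ (Submodule.span ℝ
      ((fun j : Fin d => EuclideanSpace.single j (1 : ℝ)) '' (J : Set (Fin d))) :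
        Submodule ℝ 𝔼) = J.card := by
  have hli : LinearIndependent ℝ fun j : J => (EuclideanSpace.single (j : Fin d) (1 : ℝ) : 𝔼) := by
    have h := (EuclideanSpace.basisFun (Fin d) ℝ).toBasis.linearIndependent.comp
      (fun j : J => (j : Fin d)) Subtype.val_injective
    simpa [Function.comp_def] using h
  have h := finrank_span_eq_card hli
  rw [Fintype.card_coe] at h
  rw [← h, Set.image_eq_range]
  rfl

theorem starProjection_span_single (J : Set (Fin d)) (x v : 𝔼) (hv : ∀ k ∉ J, v k = 0)
    (hxv : ∀ k ∈ J, v k = x k) :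
    (Submodule.span ℝ ((fun j : Fin d => EuclideanSpace.single j (1 : ℝ)) '' J)).starProjection x
      = v := by
  refine Submodule.eq_starProjection_of_mem_of_inner_eq_zero (mem_span_single.2 hv) fun w hw => ?_
  rw [mem_span_single] at hw
  rw [PiLp.inner_apply]
  refine Finset.sum_eq_zero fun k _ => ?_
  by_cases hk : k ∈ J
  · simp [hxv k hk]
  · simp [hw k hk]

theorem isBlock_univ {P : Set 𝔼} (hne : P.Nonempty) (hP : IsPolytope P)
    (hanti : IsLocallyAntiBlocking P) (hnorm : IsNormalized P) : IsBlock P Finset.univ := by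
  have hproj : ∀ (J : Set (Fin d)) (x v : 𝔼), x ∈ P → (∀ k ∉ J, v k = 0) →
      (∀ k ∈ J, v k = x k) → v ∈ P := by
    intro J x v hx hv hxv
    have h := hanti _ ⟨J, rfl⟩
    have hmem : v ∈ (fun x => (Submodule.span ℝ
        ((fun j : Fin d => EuclideanSpace.single j (1 : ℝ)) '' J)).starProjection x) '' P :=
      ⟨x, hx, starProjection_span_single J x v hv hxv⟩
    rw [h] at hmem
    exact hmem.1
  have hin : ∀ (x : 𝔼) i, ⟪x, EuclideanSpace.single i (1 : ℝ)⟫ = x i := fun x i => by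
    simp [EuclideanSpace.inner_single_right]
  have hsingle : ∀ (x : 𝔼) i, x ∈ P → EuclideanSpace.single i (x i) ∈ P := fun x i hx =>
    hproj {i} x _ hx (fun k hk => by simp [show k ≠ i by simpa using hk])
      (fun k hk => by rw [show k = i from hk]; simp)
  refine ⟨hP, ?_, ?_, fun x _ i hi => absurd (Finset.mem_univ i) hi, ?_, ?_⟩
  · intro i x hx
    exact hproj {i}ᶜ x _ hx (fun k hk => by simp [show k = i by simpa using hk])
      (fun k hk => drop_apply_of_ne (by simpa using hk) x)
  · rintro i - s (rfl | rfl)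
    · obtain ⟨x, hx, hxi⟩ := (hnorm i).1.1
      have hxi : x i = 1 := by rw [← hin]; exact hxi
      rw [← hxi]; exact hsingle x i hx
    · obtain ⟨x, hx, hxi⟩ := (hnorm i).2.1
      have hxi : x i = -1 := by
        have : ⟪x, -EuclideanSpace.single i (1 : ℝ)⟫ = 1 := hxi
        rw [inner_neg_right, hin] at this
        linarith
      rw [← hxi]; exact hsingle x i hx
  · intro x hx i
    have h1 : ⟪x, EuclideanSpace.single i (1 : ℝ)⟫ ≤ 1 := (hnorm i).1.2 ⟨x, hx, rfl⟩
    have h2 : ⟪x, -EuclideanSpace.single i (1 : ℝ)⟫ ≤ 1 := (hnorm i).2.2 ⟨x, hx, rfl⟩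
    rw [hin] at h1
    rw [inner_neg_right, hin] at h2
    exact abs_le.2 ⟨by linarith, h1⟩
  · obtain ⟨x, hx⟩ := hne
    exact hproj ∅ x 0 hx (fun k _ => rfl) (fun k hk => absurd hk (Set.notMem_empty k))

/-- The sections of `P` by coordinate subspaces are minimal, provided that `P` is not empty. -/
theorem isMinimal_inter_span {P : Set 𝔼} (hne : P.Nonempty) (hP : IsPolytope P)
    (hanti : IsLocallyAntiBlocking P) (hnorm : IsNormalized P)
    (hflags : (flags P).ncard = 2 ^ d * d !) (J : Finset (Fin d)) :
    IsMinimal (P ∩ (Submodule.span ℝ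
      ((fun j : Fin d => EuclideanSpace.single j (1 : ℝ)) '' (J : Set (Fin d))) :
        Submodule ℝ 𝔼)) J := by
  have hB := isBlock_univ hne hP hanti hnorm
  have hmin : IsMinimal P Finset.univ := isMinimal_of_ncard hB (by
    rw [← ncard_flags hB.dim_eq, hflags, Finset.card_univ, Fintype.card_fin])
  convert hmin.inter_coords Jᶜ using 1
  · ext x
    simp only [Set.mem_inter_iff, SetLike.mem_coe, mem_span_single, Set.mem_ofPred_eq,
      Finset.mem_compl]
  · ext k; simp

end FlagPolytope

theorem mainTheorem4 (d : ℕ) (P : Set (EuclideanSpace ℝ (Fin d)))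
    (hP : FlagPolytope.IsPolytope P)
    (hanti : FlagPolytope.IsLocallyAntiBlocking P)
    (hnorm : FlagPolytope.IsNormalized P)
    (hflags : (FlagPolytope.flags P).ncard = 2 ^ d * d !) :
    (∀ H : Submodule ℝ (EuclideanSpace ℝ (Fin d)), FlagPolytope.IsCoordinateSubspace H →
      (FlagPolytope.flags (P ∩ (H : Set (EuclideanSpace ℝ (Fin d))))).ncard =
        2 ^ Module.finrank ℝ H * (Module.finrank ℝ H)!) ∧
    (∀ H : Submodule ℝ (EuclideanSpace ℝ (Fin d)), FlagPolytope.IsCoordinateSubspace H →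
      Module.finrank ℝ H = 2 →
        P ∩ (H : Set (EuclideanSpace ℝ (Fin d))) =
            FlagPolytope.cube d ∩ (H : Set (EuclideanSpace ℝ (Fin d))) ∨
        P ∩ (H : Set (EuclideanSpace ℝ (Fin d))) =
            FlagPolytope.diamond d ∩ (H : Set (EuclideanSpace ℝ (Fin d)))) := by
  classical
  rcases P.eq_empty_or_nonempty with rfl | hne
  · -- Normalization allows the empty polytope only in dimension `0`.
    obtain rfl : d = 0 := by
      by_contra hd
      obtain ⟨x, hx, -⟩ := (hnorm ⟨0, Nat.pos_of_ne_zero hd⟩).1.1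
      exact hx
    have hrank : ∀ H : Submodule ℝ (EuclideanSpace ℝ (Fin 0)), Module.finrank ℝ H = 0 := fun H =>
      Module.finrank_zero_of_subsingleton
    refine ⟨fun H _ => ?_, fun H _ h => ?_⟩
    · rw [Set.empty_inter, hrank, hflags]
    · rw [hrank] at h
      exact absurd h (by norm_num)
  have hfin : ∀ J : Set (Fin d), ∃ J' : Finset (Fin d), J = J' := fun J =>
    ⟨J.toFinite.toFinset, by simp⟩
  constructor
  · rintro _ ⟨J, rfl⟩
    obtain ⟨J, rfl⟩ := hfin J
    have hmin := FlagPolytope.isMinimal_inter_span hne hP hanti hnorm hflags J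
    rw [FlagPolytope.ncard_flags hmin.block.dim_eq, hmin.ncard_fullChains,
      FlagPolytope.finrank_span_single]
  · rintro _ ⟨J, rfl⟩ hrank
    obtain ⟨J, rfl⟩ := hfin J
    have hmin := FlagPolytope.isMinimal_inter_span hne hP hanti hnorm hflags J
    rw [FlagPolytope.finrank_span_single] at hrank
    obtain ⟨i, j, hij, rfl⟩ := Finset.card_eq_two.1 hrank
    set H := Submodule.span ℝ ((fun j : Fin d => EuclideanSpace.single j (1 : ℝ)) ''
      (({i, j} : Finset (Fin d)) : Set (Fin d)))
    have hH : ∀ x ∈ H, ∀ k, k ≠ i → k ≠ j → x k = 0 := fun x hx k hki hkj =>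
      FlagPolytope.mem_span_single.1 hx k (by simp [hki, hkj])
    refine (hmin.square_or_diamond hij).imp (fun h => ?_) (fun h => ?_)
    · ext x
      refine ⟨fun hx => ⟨fun k => hmin.block.abs_le x hx k, hx.2⟩, fun ⟨hc, hx⟩ => ?_⟩
      exact (h x (hH x hx)).2 ⟨hc i, hc j⟩
    · have hsum : ∀ x ∈ H, ∑ k, |x k| = |x i| + |x j| := fun x hx => by
        rw [← Finset.sum_subset (Finset.subset_univ {i, j}) fun k _ hk => ?_, Finset.sum_pair hij]
        rw [Finset.mem_insert, Finset.mem_singleton, not_or] at hk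
        rw [hH x hx k hk.1 hk.2, abs_zero]
      ext x
      refine ⟨fun hx => ⟨?_, hx.2⟩, fun ⟨hc, hx⟩ => ?_⟩
      · exact (hsum x hx.2).trans_le ((h x (hH x hx.2)).1 hx)
      · exact (h x (hH x hx)).2 ((hsum x hx).symm.trans_le hc)
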